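/- Let $d\ge 1$, $m>0$, $\sigma\ge 0$ and $C>0$ with $C\ge \sigma/m$. Let $\Gamma_0$ be the space of finite subsets of $\mathbb R^d$ with its Borel $\sigma$-algebra (as the disjoint union over $n\ge 0$ of the spaces of $n$-point subsets, each regarded as the quotient of the space of $n$-tuples of distinct points by permutations), and let $\lambda=\sum_{n\ge 0}\frac1{n!}\mathrm m^{(n)}$ be the Lebesgue–Poisson measure on $\Gamma_0$, where $\mathrm m^{(n)}$ is the image of Lebesgue measure on $(\mathbb R^d)^n$ (restricted to tuples of distinct points) under $(x_1,\dots,x_n)\mapsto\{x_1,\dots,x_n\}$. For $C'>0$ let $\mathcal L_{C'}$ be the Banach space of measurable $G:\Gamma_0\to\mathbb R$ with $\|G\|_{C'}=\int_{\Gamma_0}|G(\eta)|\,C'^{|\eta|}\,d\lambda(\eta)<\infty$, and let $\mathcal K_C$ be the space of measurable $k:\Gamma_0\to\mathbb R$ with $C^{-|\cdot|}k\in L^\infty(\Gamma_0,\lambda)$ (functions in either space are identified when they agree $\lambda$-a.e.); the two spaces are in duality by $\langle\!\langle G,k\rangle\!\rangle=\int_{\Gamma_0}G\,k\,d\lambda$.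 Consider on $\mathcal L_C$ the operator $$(\hat L G)(\eta)=-m|\eta|\,G(\eta)+\sigma\int_{\mathbb R^d}G(\eta\cup\{x\})\,dx$$ with domain $\mathcal L_{2C}$. Then $(\hat L,\mathcal L_{2C})$ is a well-defined operator in $\mathcal L_C$, its closure is the generator of exactly one strongly continuous contraction semigroup $(\hat T(t))_{t\ge0}$ on $\mathcal L_C$, and there is exactly one family $(\hat T^*(t))_{t\ge 0}$ of linear operators on $\mathcal K_C$ that is adjoint to it, i.e. $\langle\!\langle \hat T(t)G,k\rangle\!\rangle=\langle\!\langle G,\hat T^*(t)k\rangle\!\rangle$ for all $G\in\mathcal L_C$, $k\in\mathcal K_C$, $t\ge0$. For every $k\in\mathcal K_C$ and $t\ge 0$, and for $\lambda$-a.a. $\eta\in\Gamma_0$, $$(\hat T^*(t)k)(\eta)=e^{-tm|\eta|}\Bigl(e_\lambda\bigl(\tfrac{\sigma}{m}(e^{tm}-1)\bigr)*k\Bigr)(\eta),$$ where $e_\lambda(f,\eta)=\prod_{x\in\eta}f(x)$ (equal to $1$ for $\eta=\emptyset$) and $(G_1*G_2)(\eta)=\sum_{\xi\subseteq\eta}G_1(\xi)\,G_2(\eta\setminus\xi)$.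 -/

import Mathlib

open MeasureTheory Filter Topology
open scoped ENNReal NNReal

noncomputable section

/-- Finite configurations (finite subsets, possibly empty) of `ℝ^d`. This is a structure, and not
`Finset` itself, because `Finset` carries another (smaller) σ-algebra in Mathlib. -/
@[ext]
structure FinConf (d : ℕ) where
  /-- The points of the configuration. -/
  pts : Finset (EuclideanSpace ℝ (Fin d))

namespace FinConf

variable {d : ℕ}

/-- The number `|η|` of points of `η`. -/
def card (η : FinConf d) : ℕ := η.pts.card

open scoped Classical in
/-- The configuration `η ∪ {x}`. -/
def add (η : FinConf d) (x : EuclideanSpace ℝ (Fin d)) : FinConf d := ⟨insert x η.pts⟩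

/-- Ordered `n`-tuples of pairwise distinct points of `ℝ^d`. -/
abbrev Tuple (d n : ℕ) : Type :=
  {x : Fin n → EuclideanSpace ℝ (Fin d) // Function.Injective x}

/-- The symmetrization map `(x₁, …, xₙ) ↦ {x₁, …, xₙ}` on tuples of distinct points. -/
def ofTuple (n : ℕ) (x : Tuple d n) : FinConf d := ⟨Finset.univ.map ⟨x.1, x.2⟩⟩

/-- The Borel σ-algebra of the disjoint union over `n` of the spaces of `n`-point configurations,
each of which is the quotient of the space of `n`-tuples of distinct points by permutations: a set
is measurable iff, for each `n`, its preimage in the space of tuples is a Borel set. -/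
instance : MeasurableSpace (FinConf d) :=
  ⨅ n : ℕ, MeasurableSpace.map (ofTuple (d := d) n) inferInstance

theorem measurable_iff {β : Type*} [MeasurableSpace β] {f : FinConf d → β} :
    Measurable f ↔ ∀ n, Measurable fun x : Tuple d n => f (ofTuple n x) := by
  constructor
  · intro h n s hs
    have := h hs
    rw [MeasurableSpace.measurableSet_iInf] at this
    exact this n
  · intro h s hs
    rw [MeasurableSpace.measurableSet_iInf]
    exact fun n => h n hs

@[simp]
theorem card_ofTuple (n : ℕ) (x : Tuple d n) : (ofTuple n x).card = n := by
  simp [card, ofTuple]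

theorem measurable_card : Measurable (card : FinConf d → ℕ) := by
  rw [measurable_iff]
  intro n
  simp only [card_ofTuple]
  exact measurable_const

/-- The Lebesgue–Poisson measure `λ = ∑ₙ (1/n!) m⁽ⁿ⁾` (activity `1`), where `m⁽ⁿ⁾` is the image
under symmetrization of the Lebesgue measure on `n`-tuples of distinct points. -/
def lebesguePoisson (d : ℕ) : Measure (FinConf d) :=
  Measure.sum fun n : ℕ =>
    ((n.factorial : ℝ≥0∞)⁻¹) •
      Measure.map (ofTuple n) (Measure.comap (Subtype.val : Tuple d n → _) volume)

/-- The measure `λ_C(dη) = C^{|η|} λ(dη)`. -/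
def weighted (d : ℕ) (C : ℝ) : Measure (FinConf d) :=
  (lebesguePoisson d).withDensity fun η => ENNReal.ofReal C ^ η.card

/-- The coherent state `e_λ(f, η) = ∏_{x ∈ η} f(x)` (equal to `1` at `η = ∅`). -/
def coherent (f : EuclideanSpace ℝ (Fin d) → ℝ) (η : FinConf d) : ℝ := ∏ x ∈ η.pts, f x

open scoped Classical in
/-- The convolution `(G₁ ∗ G₂)(η) = ∑_{ξ ⊆ η} G₁(ξ) G₂(η \ ξ)`. -/
def conv (G₁ G₂ : FinConf d → ℝ) (η : FinConf d) : ℝ :=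
  ∑ ξ ∈ η.pts.powerset, G₁ ⟨ξ⟩ * G₂ ⟨η.pts \ ξ⟩

end FinConf

open FinConf

/-- The Banach space `L_C` of (classes of) measurable `G : Γ₀ → ℝ` with
`‖G‖_C = ∫ |G(η)| C^{|η|} dλ(η) < ∞`. -/
abbrev LC (d : ℕ) (C : ℝ) : Type := Lp ℝ 1 (weighted d C)

/-- The expression `(L̂G)(η) = -m |η| G(η) + σ ∫ G(η ∪ {x}) dx`. -/
def lHat {d : ℕ} (m σ : ℝ) (g : FinConf d → ℝ) (η : FinConf d) : ℝ :=
  -m * (η.card : ℝ) * g η + σ * ∫ x, g (η.add x)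

/-- The graph, in `L_C × L_C`, of the operator `(L̂, L_{2C})`: its elements are the pairs
`(G, H)` with `G ∈ L_{2C}` and `H = L̂G`. -/
def lHatGraph (d : ℕ) (m σ C : ℝ) : Submodule ℝ (LC d C × LC d C) where
  carrier := {p | ∃ g : FinConf d → ℝ, Measurable g ∧ p.1 =ᵐ[weighted d C] g ∧
    Integrable g (weighted d (2 * C)) ∧
    (∀ᵐ η ∂(weighted d C), Integrable fun x => g (η.add x)) ∧
    p.2 =ᵐ[weighted d C] lHat m σ g}
  zero_mem' := by
    refine ⟨0, measurable_zero, Lp.coeFn_zero _ _ _, integrable_zero _ _ _, ?_, ?_⟩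
    · exact Eventually.of_forall fun η => integrable_zero _ _ _
    · filter_upwards [Lp.coeFn_zero ℝ 1 (weighted d C)] with η h
      simpa [lHat] using h
  add_mem' := by
    rintro p q ⟨g, hg, hpg, hig, hsg, hLg⟩ ⟨h, hh, hqh, hih, hsh, hLh⟩
    refine ⟨g + h, hg.add hh, ?_, hig.add hih, ?_, ?_⟩
    · exact (Lp.coeFn_add p.1 q.1).trans (hpg.add hqh)
    · filter_upwards [hsg, hsh] with η h1 h2
      exact h1.add h2
    · filter_upwards [Lp.coeFn_add p.2 q.2, hsg, hsh, hLg, hLh] with η h0 h1 h2 h3 h4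
      have h5 : ∫ x, (g + h) (η.add x) = (∫ x, g (η.add x)) + ∫ x, h (η.add x) :=
        integral_add h1 h2
      rw [Prod.snd_add, h0, Pi.add_apply, h3, h4, lHat, lHat, lHat, h5, Pi.add_apply]
      ring
  smul_mem' := by
    rintro c p ⟨g, hg, hpg, hig, hsg, hLg⟩
    refine ⟨c • g, hg.const_smul c, ?_, hig.smul c, ?_, ?_⟩
    · exact (Lp.coeFn_smul c p.1).trans (hpg.const_smul c)
    · filter_upwards [hsg] with η h1
      exact h1.smul c
    · filter_upwards [Lp.coeFn_smul c p.2, hLg] with η h0 h3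
      have h5 : ∫ x, (c • g) (η.add x) = c • ∫ x, g (η.add x) :=
        integral_smul c fun x => g (η.add x)
      rw [Prod.smul_snd, h0, Pi.smul_apply, h3, lHat, lHat, h5]
      simp only [Pi.smul_apply, smul_eq_mul]
      ring

/-- Strongly continuous contraction semigroups on a real Banach space. -/
structure IsC0ContractionSemigroup {X : Type*} [NormedAddCommGroup X] [NormedSpace ℝ X]
    (T : ℝ≥0 → X →L[ℝ] X) : Prop where
  map_zero : T 0 = ContinuousLinearMap.id ℝ X
  map_add : ∀ s t, T (s + t) = (T s).comp (T t)
  contraction : ∀ t, ‖T t‖ ≤ 1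
  strong_cont : ∀ G, Continuous fun t => T t G

/-- The graph of the infinitesimal generator of `T`: the pairs `(G, H)` such that
`(T(t)G - G)/t → H` in norm as `t ↓ 0`. -/
def generatorGraph {X : Type*} [NormedAddCommGroup X] [NormedSpace ℝ X]
    (T : ℝ≥0 → X →L[ℝ] X) : Set (X × X) :=
  {p | Tendsto (fun t : ℝ≥0 => (t : ℝ)⁻¹ • (T t p.1 - p.1)) (𝓝[>] 0) (𝓝 p.2)}

/-- `T` is a strongly continuous contraction semigroup on `L_C` whose generator is the closure of
`(L̂, L_{2C})`. -/
def IsHatSemigroup (d : ℕ) (m σ C : ℝ) (T : ℝ≥0 → LC d C →L[ℝ] LC d C) : Prop :=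
  IsC0ContractionSemigroup T ∧
    generatorGraph T = closure (lHatGraph d m σ C : Set (LC d C × LC d C))

/-- The space `K_C` of (classes modulo `λ`-a.e. equality of) measurable `k : Γ₀ → ℝ` with
`k · C^{-|·|} ∈ L^∞(Γ₀, λ)`. -/
def KC (d : ℕ) (C : ℝ) : Submodule ℝ (FinConf d →ₘ[lebesguePoisson d] ℝ) where
  carrier := {k | MemLp (fun η => (C ^ η.card)⁻¹ * k η) ∞ (lebesguePoisson d)}
  zero_mem' := by
    refine (MemLp.zero (ε := ℝ)).ae_eq ?_
    filter_upwards [AEEqFun.coeFn_zero (β := ℝ) (μ := lebesguePoisson d)] with η h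
    simp [h]
  add_mem' := by
    intro k l hk hl
    refine (hk.add hl).ae_eq ?_
    filter_upwards [AEEqFun.coeFn_add k l] with η h
    simp only [h, Pi.add_apply]
    ring
  smul_mem' := by
    intro c k hk
    refine (hk.const_smul c).ae_eq ?_
    filter_upwards [AEEqFun.coeFn_smul c k] with η h
    simp only [h, Pi.smul_apply, smul_eq_mul]
    ring

/-- The duality `⟨⟨G, k⟩⟩ = ∫ G k dλ` between `L_C` and `K_C`. -/
def pairing {d : ℕ} {C : ℝ} (G : LC d C) (k : KC d C) : ℝ :=
  ∫ η, G η * k.1 η ∂(lebesguePoisson d)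

/-- `S` is the family on `K_C` adjoint to the family `T` on `L_C` with respect to the duality
`⟨⟨G, k⟩⟩`. -/
def IsAdjointFamily {d : ℕ} {C : ℝ} (T : ℝ≥0 → LC d C →L[ℝ] LC d C)
    (S : ℝ≥0 → KC d C →ₗ[ℝ] KC d C) : Prop :=
  ∀ t G k, pairing (T t G) k = pairing G (S t k)

end

/-!
Why the theorem holds. Write `μ = C^{|η|} dλ`, `p = e^{-tm}` and `q = (σ / (m C)) (1 - p)`; the
hypothesis `σ / m ≤ C` says exactly that `p + q ≤ 1`. Keeping each point with weight `p` and
deleting it with weight `q` is then a sub-Markov kernel `K_t h(η) = ∑_{ζ ⊆ η} p^{|ζ|} q^{|η \ ζ|} h(ζ)`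
on finite configurations, and the semigroup is the predual action of `K_t` on `L¹(μ) = L_C`:
`∫ (T(t) G) h dμ = ∫ G (K_t h) dμ` for bounded measurable `h`. All analysis is done through this
identity, where the action on `h` is a finite sum at each `η`.

* The kernel does not charge `μ`-null sets (`FinConf.ae_subset`, an iteration of the Mecke formula
  `FinConf.lintegral_add_mul`), so transported measures have densities by Radon–Nikodym and `T(t)`
  exists as a contraction (`MeasureTheory.exists_predual`, `exists_isThinning`).
* Two thinnings compose to a thinning (`FinConf.subsetSum_subsetSum`), which is the semigroup law;
  strong continuity is dominated convergence (`tendsto_integral_subsetSum`).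
* The derivative of the thinning weights at `t = 0` is `-m k` for no deleted point and `σ / C` for
  one deleted point; by the Mecke formula this is the dual of `L̂`. On `L_{2C}` the difference
  quotients are dominated by a multiple of `2^{|η|} |G|`, so `L̂` is a restriction of the generator
  (`IsThinning.lHatGraph_subset`).
* `L_{2C}` is dense and invariant under `T(t)`, hence a core
  (`IsC0ContractionSemigroup.closure_eq_generatorGraph`), and a contraction semigroup is determined
  by its densely defined generator (`IsC0ContractionSemigroup.eq_of_generatorGraph_eq`). No strict
  inequality between `σ / m` and `C` is needed.
* The adjoint on `K_C` is `K_t` conjugated by `C^{|·|}`, which is the stated convolution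
  (`adjointFun_eq_conv`); it is unique since the duality separates `K_C` (`eq_of_pairing_eq`).
-/

/-! ### Strongly continuous contraction semigroups -/

namespace IsC0ContractionSemigroup

variable {X : Type*} [NormedAddCommGroup X] [NormedSpace ℝ X] {T S : ℝ≥0 → X →L[ℝ] X}

theorem norm_apply_le (hT : IsC0ContractionSemigroup T) (t : ℝ≥0) (x : X) : ‖T t x‖ ≤ ‖x‖ := by
  simpa using (T t).le_of_opNorm_le (hT.contraction t) x

theorem add_apply (hT : IsC0ContractionSemigroup T) (s t : ℝ≥0) (x : X) :
    T (s + t) x = T s (T t x) := by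
  rw [hT.map_add]; rfl

theorem comm_apply (hT : IsC0ContractionSemigroup T) (s t : ℝ≥0) (x : X) :
    T s (T t x) = T t (T s x) := by
  rw [← hT.add_apply, add_comm, hT.add_apply]

/-- Contractivity upgrades strong continuity to joint continuity. -/
theorem tendsto_apply (hT : IsC0ContractionSemigroup T) {ι : Type*} {l : Filter ι} {a : ι → ℝ≥0}
    {b : ℝ≥0} {x : ι → X} {y : X} (ha : Tendsto a l (𝓝 b)) (hx : Tendsto x l (𝓝 y)) :
    Tendsto (fun i => T (a i) (x i)) l (𝓝 (T b y)) := by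
  have h1 : Tendsto (fun i => T (a i) y) l (𝓝 (T b y)) := ((hT.strong_cont y).tendsto b).comp ha
  have h2 : Tendsto (fun i => T (a i) (x i - y)) l (𝓝 0) := by
    refine squeeze_zero_norm (fun i => hT.norm_apply_le _ _) ?_
    simpa using (hx.sub_const y).norm
  simpa using h2.add h1

theorem continuous_orbit (hT : IsC0ContractionSemigroup T) (x : X) :
    Continuous fun r : ℝ => T r.toNNReal x :=
  (hT.strong_cont x).comp continuous_real_toNNReal

theorem apply_mem_generatorGraph (hT : IsC0ContractionSemigroup T) {G H : X}
    (h : (G, H) ∈ generatorGraph T) (s : ℝ≥0) : (T s G, T s H) ∈ generatorGraph T := by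
  have h1 : Tendsto (fun t : ℝ≥0 => T s ((t : ℝ)⁻¹ • (T t G - G))) (𝓝[>] 0) (𝓝 (T s H)) :=
    ((T s).continuous.tendsto H).comp h
  refine h1.congr fun t => ?_
  rw [map_smul, map_sub, hT.comm_apply]

theorem generatorGraph_unique {G H H' : X} (h : (G, H) ∈ generatorGraph T)
    (h' : (G, H') ∈ generatorGraph T) : H = H' :=
  tendsto_nhds_unique h h'

theorem tendsto_sub_toNNReal (s : ℝ) :
    Tendsto (fun r : ℝ => (r - s).toNNReal) (𝓝[>] s) (𝓝[>] 0) := by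
  refine tendsto_nhdsWithin_iff.2 ⟨?_, ?_⟩
  · have : Continuous fun r : ℝ => (r - s).toNNReal := by fun_prop
    simpa using (this.tendsto s).mono_left nhdsWithin_le_nhds
  · filter_upwards [self_mem_nhdsWithin] with r hr
    simpa using hr

theorem tendsto_slope {G H : X} (h : (G, H) ∈ generatorGraph T) (s : ℝ) :
    Tendsto (fun r : ℝ => (r - s)⁻¹ • (T (r - s).toNNReal G - G)) (𝓝[>] s) (𝓝 H) := by
  refine (Tendsto.comp (show Tendsto _ _ _ from h) (tendsto_sub_toNNReal s)).congr' ?_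
  filter_upwards [self_mem_nhdsWithin] with r hr
  have : 0 ≤ r - s := sub_nonneg.2 (le_of_lt hr)
  simp [Function.comp, this]

theorem hasDerivWithinAt_orbit (hT : IsC0ContractionSemigroup T) {G H : X}
    (h : (G, H) ∈ generatorGraph T) {s : ℝ} (hs : 0 ≤ s) :
    HasDerivWithinAt (fun r : ℝ => T r.toNNReal G) (T s.toNNReal H) (Set.Ioi s) s := by
  rw [hasDerivWithinAt_iff_tendsto_slope' (Set.self_notMem_Ioi)]
  refine (((T s.toNNReal).continuous.tendsto H).comp (tendsto_slope h s)).congr' ?_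
  filter_upwards [self_mem_nhdsWithin] with r hr
  have hr' : 0 ≤ r - s := sub_nonneg.2 (le_of_lt hr)
  have e : r.toNNReal = s.toNNReal + (r - s).toNNReal := by
    rw [← Real.toNNReal_add hs hr']; congr 1; ring
  simp only [Function.comp, slope_def_module, map_smul, map_sub]
  rw [e, hT.add_apply]

/-- A contraction semigroup whose generator is densely defined is determined by its generator:
`s ↦ T (t - s) (S s G)` has right derivative zero for `G` in the common domain. -/
theorem eq_of_generatorGraph_eq (hT : IsC0ContractionSemigroup T)
    (hS : IsC0ContractionSemigroup S) (hTS : generatorGraph T = generatorGraph S)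
    (hd : Dense {G | ∃ H, (G, H) ∈ generatorGraph T}) : T = S := by
  funext t
  refine ContinuousLinearMap.coeFn_injective
    (Continuous.ext_on hd (T t).continuous (S t).continuous ?_)
  rintro G ⟨H, hGH⟩
  let f : ℝ → X := fun r => T (t - r).toNNReal (S r.toNNReal G)
  have hf : Continuous f := continuous_iff_continuousAt.2 fun r => by
    refine hT.tendsto_apply (b := (t - r).toNNReal) ?_ ((hS.continuous_orbit G).tendsto r)
    have : Continuous fun r : ℝ => (t - r).toNNReal := by fun_prop
    exact this.tendsto r
  have hder : ∀ s ∈ Set.Ico (0 : ℝ) t, HasDerivWithinAt f 0 (Set.Ici s) s := by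
    rintro s ⟨hs0, hst⟩
    rw [← hasDerivWithinAt_Ioi_iff_Ici,
      hasDerivWithinAt_iff_tendsto_slope' (Set.self_notMem_Ioi)]
    have hS' := hS.apply_mem_generatorGraph (hTS ▸ hGH) s.toNNReal
    have hT' := hS'
    rw [← hTS] at hT'
    have h0 : Tendsto (fun r : ℝ => T (t - r).toNNReal
        ((r - s)⁻¹ • (S (r - s).toNNReal (S s.toNNReal G) - S s.toNNReal G) -
          (r - s)⁻¹ • (T (r - s).toNNReal (S s.toNNReal G) - S s.toNNReal G)))
        (𝓝[>] s) (𝓝 (T (t - s).toNNReal (S s.toNNReal H - S s.toNNReal H))) := by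
      refine hT.tendsto_apply ?_ ((tendsto_slope hS' s).sub (tendsto_slope hT' s))
      have : Continuous fun r : ℝ => (t - r).toNNReal := by fun_prop
      exact (this.tendsto s).mono_left nhdsWithin_le_nhds
    rw [sub_self, _root_.map_zero] at h0
    refine h0.congr' ?_
    filter_upwards [self_mem_nhdsWithin, Ioo_mem_nhdsGT hst] with r hr hrt
    have hr' : 0 ≤ r - s := sub_nonneg.2 (le_of_lt hr)
    have hrt' : 0 ≤ t - r := sub_nonneg.2 hrt.2.le
    have e1 : r.toNNReal = (r - s).toNNReal + s.toNNReal := by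
      rw [← Real.toNNReal_add hr' hs0]; congr 1; ring
    have e2 : ((t : ℝ) - s).toNNReal = (t - r).toNNReal + (r - s).toNNReal := by
      rw [← Real.toNNReal_add hrt' hr']; congr 1; ring
    simp only [f, slope_def_module]
    rw [e2, hT.add_apply, e1, hS.add_apply, ← smul_sub, map_smul, ← map_sub]
    congr 2
    abel
  have := constant_of_has_deriv_right_zero hf.continuousOn hder t ⟨t.coe_nonneg, le_rfl⟩
  simpa [f, hT.map_zero, hS.map_zero, eq_comm] using this

theorem continuous_integral_orbit (hT : IsC0ContractionSemigroup T) (t : ℝ≥0) :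
    Continuous fun H : X => ∫ r in (0 : ℝ)..t, T r.toNNReal H := by
  refine continuous_iff_continuousAt.2 fun H => ?_
  rw [ContinuousAt, tendsto_iff_norm_sub_tendsto_zero]
  have h0 : Tendsto (fun H' : X => ‖H' - H‖ * |(t : ℝ) - 0|) (𝓝 H) (𝓝 0) := by
    have : Continuous fun H' : X => ‖H' - H‖ * |(t : ℝ) - 0| := by fun_prop
    simpa using this.tendsto H
  refine squeeze_zero (fun _ => norm_nonneg _) (fun H' => ?_) h0
  rw [← intervalIntegral.integral_sub ((hT.continuous_orbit H').intervalIntegrable _ _)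
    ((hT.continuous_orbit H).intervalIntegrable _ _)]
  refine intervalIntegral.norm_integral_le_of_norm_le_const fun r _ => ?_
  rw [← map_sub]
  exact hT.norm_apply_le _ _

section Complete

variable [CompleteSpace X]

theorem apply_sub_eq_integral (hT : IsC0ContractionSemigroup T) {G H : X}
    (h : (G, H) ∈ generatorGraph T) (t : ℝ≥0) :
    ∫ r in (0 : ℝ)..t, T r.toNNReal H = T t G - G := by
  rw [intervalIntegral.integral_eq_sub_of_hasDeriv_right_of_le (f := fun r => T r.toNNReal G)
      t.coe_nonneg
    (hT.continuous_orbit G).continuousOn (fun s hs => hT.hasDerivWithinAt_orbit h hs.1.le)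
    ((hT.continuous_orbit H).intervalIntegrable _ _)]
  simp [hT.map_zero]

/-- The mean of an orbit over `[0, t]` tends to its value at `0`. -/
theorem tendsto_average (hT : IsC0ContractionSemigroup T) (H : X) :
    Tendsto (fun t : ℝ≥0 => (t : ℝ)⁻¹ • ∫ r in (0 : ℝ)..t, T r.toNNReal H) (𝓝[>] 0) (𝓝 H) := by
  have hc := hT.continuous_orbit H
  have h1 : HasDerivAt (fun u => ∫ r in (0 : ℝ)..u, T r.toNNReal H) (T (0 : ℝ).toNNReal H) 0 :=
    intervalIntegral.integral_hasDerivAt_right (hc.intervalIntegrable _ _)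
      (hc.stronglyMeasurableAtFilter _ _) hc.continuousAt
  have h2 := h1.tendsto_slope
  simp only [hT.map_zero, Real.toNNReal_zero, ContinuousLinearMap.id_apply] at h2
  have h3 : Tendsto (fun t : ℝ≥0 => (t : ℝ)) (𝓝[>] 0) (𝓝[≠] 0) := by
    refine tendsto_nhdsWithin_iff.2 ⟨?_, ?_⟩
    · exact (NNReal.continuous_coe.tendsto 0).mono_left nhdsWithin_le_nhds
    · filter_upwards [self_mem_nhdsWithin] with r hr
      simpa using ne_of_gt hr
  refine (h2.comp h3).congr fun t => ?_
  simp [Function.comp, slope_def_module]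

theorem mem_generatorGraph_iff (hT : IsC0ContractionSemigroup T) {G H : X} :
    (G, H) ∈ generatorGraph T ↔ ∀ t : ℝ≥0, ∫ r in (0 : ℝ)..t, T r.toNNReal H = T t G - G := by
  refine ⟨hT.apply_sub_eq_integral, fun h => ?_⟩
  refine (hT.tendsto_average H).congr fun t => ?_
  rw [h]

theorem isClosed_generatorGraph (hT : IsC0ContractionSemigroup T) :
    IsClosed (generatorGraph T) := by
  have : generatorGraph T = ⋂ t : ℝ≥0,
      {p : X × X | ∫ r in (0 : ℝ)..t, T r.toNNReal p.2 = T t p.1 - p.1} := by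
    ext ⟨G, H⟩
    simp only [Set.mem_iInter, Set.mem_ofPred_eq]
    exact hT.mem_generatorGraph_iff
  rw [this]
  refine isClosed_iInter fun t => isClosed_eq
    ((hT.continuous_integral_orbit t).comp continuous_snd) ?_
  fun_prop

/-- A restriction of the generator to a dense, invariant subspace has the generator as its
closure. Averages over `[0, t]` of orbits in the graph stay in its closure; the average of the
orbit of `(G, A G)` is `(t⁻¹ ∫ T(r) G dr, t⁻¹ (T(t) G - G))`, whose second entry no longer involves
the generator, so that one may first approximate `G` and then let `t ↓ 0`. -/
theorem closure_eq_generatorGraph (hT : IsC0ContractionSemigroup T) (V : Submodule ℝ (X × X))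
    (hV : (V : Set (X × X)) ⊆ generatorGraph T) (hd : Dense {G | ∃ H, (G, H) ∈ V})
    (hinv : ∀ t G H, (G, H) ∈ V → ∃ H', (T t G, H') ∈ V) :
    closure (V : Set (X × X)) = generatorGraph T := by
  refine Set.Subset.antisymm (closure_minimal hV hT.isClosed_generatorGraph) ?_
  rintro ⟨G, H⟩ hGH
  have hinv' : ∀ t G H, (G, H) ∈ V → (T t G, T t H) ∈ V := fun t G H h => by
    obtain ⟨H', h'⟩ := hinv t G H h
    rwa [generatorGraph_unique (hT.apply_mem_generatorGraph (hV h) t) (hV h')]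
  have hclosed : IsClosed (closure (V : Set (X × X))) := isClosed_closure
  have key : ∀ t : ℝ≥0, 0 < t → ∀ G ∈ {G | ∃ H, (G, H) ∈ V},
      ((t : ℝ)⁻¹ • ∫ r in (0 : ℝ)..t, T r.toNNReal G, (t : ℝ)⁻¹ • (T t G - G)) ∈
        closure (V : Set (X × X)) := by
    rintro t ht G ⟨H, h⟩
    have ht' : (0 : ℝ) < t := ht
    have hcont : Continuous fun r : ℝ => (T r.toNNReal G, T r.toNNReal H) :=
      (hT.continuous_orbit G).prodMk (hT.continuous_orbit H)
    have hmem : (⨍ r in Set.Ioc (0 : ℝ) t, (T r.toNNReal G, T r.toNNReal H)) ∈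
        closure (V : Set (X × X)) := by
      refine V.convex.closure.set_average_mem isClosed_closure ?_ ?_ ?_ ?_
      · simpa using ht.ne'
      · simp
      · exact Eventually.of_forall fun r => subset_closure (hinv' _ _ _ h)
      · exact (hcont.intervalIntegrable (μ := volume) 0 t).1
    rw [setAverage_eq, integral_pair (hT.continuous_orbit G).integrableOn_Ioc
      (hT.continuous_orbit H).integrableOn_Ioc, ← intervalIntegral.integral_of_le ht'.le,
      ← intervalIntegral.integral_of_le ht'.le, hT.apply_sub_eq_integral (hV h)] at hmem
    simpa using hmem
  have key2 : ∀ t : ℝ≥0, 0 < t → ∀ G : X,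
      ((t : ℝ)⁻¹ • ∫ r in (0 : ℝ)..t, T r.toNNReal G, (t : ℝ)⁻¹ • (T t G - G)) ∈
        closure (V : Set (X × X)) := by
    intro t ht G
    have hc : IsClosed {G : X | ((t : ℝ)⁻¹ • ∫ r in (0 : ℝ)..t, T r.toNNReal G,
        (t : ℝ)⁻¹ • (T t G - G)) ∈ closure (V : Set (X × X))} := by
      refine hclosed.preimage (Continuous.prodMk ?_ ?_)
      · exact (hT.continuous_integral_orbit t).const_smul _
      · fun_prop
    have := hc.closure_subset_iff.2 (key t ht)
    exact this (hd G)
  refine hclosed.mem_of_tendsto ((hT.tendsto_average G).prodMk_nhds hGH) ?_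
  filter_upwards [self_mem_nhdsWithin] with t ht
  exact key2 t ht G

end Complete

end IsC0ContractionSemigroup

/-! ### Sums over subconfigurations -/

namespace FinConf

open scoped Classical

variable {d : ℕ}

/-- The configuration `η \ {x}`. -/
noncomputable def erase (η : FinConf d) (x : EuclideanSpace ℝ (Fin d)) : FinConf d :=
  ⟨η.pts.erase x⟩

/-- The operator `h ↦ ∑_{ζ ⊆ η} W(|ζ|, |η \ ζ|) h(ζ)` with a weight depending only on the numbers
of retained and of deleted points. -/
noncomputable def subsetSum {R : Type*} [CommSemiring R] (W : ℕ → ℕ → R) (h : FinConf d → R)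
    (η : FinConf d) : R :=
  ∑ ζ ∈ η.pts.powerset, W ζ.card (η.pts \ ζ).card * h ⟨ζ⟩

theorem measurable_ofTuple (n : ℕ) : Measurable (ofTuple (d := d) n) :=
  measurable_iff.1 measurable_id n

/-- The subconfiguration of a tuple selected by a set of indices depends measurably on the tuple. -/
theorem measurable_map_ofTuple {n : ℕ} (s : Finset (Fin n)) :
    Measurable fun x : Tuple d n => (⟨s.map ⟨x.1, x.2⟩⟩ : FinConf d) := by
  have h : (fun x : Tuple d n => (⟨s.map ⟨x.1, x.2⟩⟩ : FinConf d)) = fun x =>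
      ofTuple s.card ⟨fun i => x.1 (s.orderEmbOfFin rfl i),
        x.2.comp (s.orderEmbOfFin rfl).injective⟩ := by
    funext x
    ext1
    simp only [ofTuple]
    ext a
    simp only [Finset.mem_map, Finset.mem_univ, true_and, Function.Embedding.coeFn_mk]
    constructor
    · rintro ⟨i, hi, rfl⟩
      have : i ∈ Set.range (s.orderEmbOfFin rfl) := by simpa using hi
      obtain ⟨j, rfl⟩ := this
      exact ⟨j, rfl⟩
    · rintro ⟨j, rfl⟩
      exact ⟨_, s.orderEmbOfFin_mem rfl j, rfl⟩
  rw [h]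
  refine (measurable_ofTuple _).comp (Measurable.subtype_mk ?_)
  exact measurable_pi_lambda _ fun i => (measurable_pi_apply _).comp measurable_subtype_coe

theorem subsetSum_ofTuple {R : Type*} [CommSemiring R] (W : ℕ → ℕ → R) (h : FinConf d → R)
    {n : ℕ} (x : Tuple d n) :
    subsetSum W h (ofTuple n x) =
      ∑ s : Finset (Fin n), W s.card (Finset.univ \ s).card * h ⟨s.map ⟨x.1, x.2⟩⟩ := by
  have e : (ofTuple n x).pts.powerset =
      Finset.univ.image fun s : Finset (Fin n) => s.map ⟨x.1, x.2⟩ := by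
    ext t
    simp only [Finset.mem_powerset, Finset.mem_image, Finset.mem_univ, true_and, ofTuple,
      Finset.subset_map_iff, Finset.subset_univ]
    exact exists_congr fun s => eq_comm
  rw [subsetSum, e, Finset.sum_image fun s _ t _ hst => Finset.map_injective _ hst]
  refine Finset.sum_congr rfl fun s _ => ?_
  rw [Finset.card_map, ofTuple, ← Finset.map_sdiff, Finset.card_map]

theorem measurable_subsetSum {R : Type*} [CommSemiring R] [MeasurableSpace R] [MeasurableAdd₂ R]
    [MeasurableMul₂ R] (W : ℕ → ℕ → R) {h : FinConf d → R} (hh : Measurable h) :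
    Measurable (subsetSum W h) := by
  refine measurable_iff.2 fun n => ?_
  simp only [subsetSum_ofTuple]
  exact Finset.measurable_sum _ fun s _ => (hh.comp (measurable_map_ofTuple s)).const_mul _

/-- Summation over the subsets obtained by deleting one point. -/
theorem subsetSum_single {R : Type*} [CommSemiring R] (c : R) (h : FinConf d → R)
    (η : FinConf d) :
    subsetSum (fun _ j => if j = 1 then c else 0) h η = c * ∑ x ∈ η.pts, h (η.erase x) := by
  have e : {ζ ∈ η.pts.powerset | (η.pts \ ζ).card = 1} = η.pts.image fun x => η.pts.erase x := by
    ext ζ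
    simp only [Finset.mem_filter, Finset.mem_powerset, Finset.mem_image]
    constructor
    · rintro ⟨h1, h2⟩
      obtain ⟨x, hx⟩ := Finset.card_eq_one.1 h2
      refine ⟨x, (Finset.mem_sdiff.1 (hx ▸ Finset.mem_singleton_self x)).1, ?_⟩
      rw [Finset.erase_eq, ← hx, Finset.sdiff_sdiff_eq_self h1]
    · rintro ⟨x, hx, rfl⟩
      refine ⟨Finset.erase_subset _ _, ?_⟩
      rw [Finset.erase_eq, Finset.sdiff_sdiff_eq_self (by simpa using hx)]
      simp
  have inj : Set.InjOn (fun x => η.pts.erase x) η.pts := Finset.erase_injOn η.pts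
  simp only [subsetSum, ite_mul, zero_mul]
  rw [← Finset.sum_filter, e, Finset.sum_image inj, Finset.mul_sum]
  rfl

/-! ### The Lebesgue–Poisson measure in coordinates -/

/-- The configuration of the entries of a tuple; tuples with a repeated entry, which form a null
set, are sent to the empty configuration. -/
noncomputable def toConf (n : ℕ) (x : Fin n → EuclideanSpace ℝ (Fin d)) : FinConf d :=
  if h : x ∈ {x : Fin n → EuclideanSpace ℝ (Fin d) | Function.Injective x} then ofTuple n ⟨x, h⟩
  else ⟨∅⟩

theorem toConf_of_injective {n : ℕ} {x : Fin n → EuclideanSpace ℝ (Fin d)}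
    (h : Function.Injective x) : toConf n x = ofTuple n ⟨x, h⟩ :=
  dif_pos h

theorem pts_toConf {n : ℕ} {x : Fin n → EuclideanSpace ℝ (Fin d)} (h : Function.Injective x) :
    (toConf n x).pts = Finset.univ.image x := by
  rw [toConf_of_injective h, ofTuple, Finset.map_eq_image]
  rfl

theorem measurableSet_injective (n : ℕ) :
    MeasurableSet {x : Fin n → EuclideanSpace ℝ (Fin d) | Function.Injective x} := by
  have : {x : Fin n → EuclideanSpace ℝ (Fin d) | Function.Injective x} =
      ⋂ i, ⋂ j, {x | x i = x j → i = j} := by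
    ext x
    simp [Function.Injective]
  rw [this]
  refine MeasurableSet.iInter fun i => MeasurableSet.iInter fun j => ?_
  exact (measurableSet_eq_fun (measurable_pi_apply i) (measurable_pi_apply j)).imp
    (MeasurableSet.const _)

theorem measurable_toConf (n : ℕ) : Measurable (toConf (d := d) n) :=
  Measurable.dite (s := {x : Fin n → EuclideanSpace ℝ (Fin d) | Function.Injective x})
    (measurable_ofTuple n) measurable_const (measurableSet_injective n)

theorem ae_injective (hd : 0 < d) (n : ℕ) :
    ∀ᵐ x : Fin n → EuclideanSpace ℝ (Fin d), Function.Injective x := by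
  have : NeZero d := ⟨hd.ne'⟩
  have h : ∀ i j : Fin n, ∀ᵐ x : Fin n → EuclideanSpace ℝ (Fin d), x i = x j → i = j := by
    intro i j
    by_cases hij : i = j
    · simp [hij]
    have h0 := Measure.addHaar_submodule
      (volume : Measure (Fin n → EuclideanSpace ℝ (Fin d)))
      (LinearMap.ker (LinearMap.proj (R := ℝ) (φ := fun _ => EuclideanSpace ℝ (Fin d)) i -
        LinearMap.proj j)) (fun htop => by
          obtain ⟨v, hv⟩ := exists_ne (0 : EuclideanSpace ℝ (Fin d))
          have : (Pi.single i v : Fin n → EuclideanSpace ℝ (Fin d)) ∈ LinearMap.ker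
              (LinearMap.proj (R := ℝ) (φ := fun _ => EuclideanSpace ℝ (Fin d)) i -
                LinearMap.proj j) := htop ▸ Submodule.mem_top
          simp [Ne.symm hij, hv] at this)
    refine (measure_eq_zero_iff_ae_notMem.1 h0).mono fun x hx hxij => ?_
    exact absurd (by simp [hxij]) hx
  have := ae_all_iff.2 fun i => ae_all_iff.2 (h i)
  exact this.mono fun x hx i j hij => hx i j hij

theorem lebesguePoisson_eq_sum_map (hd : 0 < d) :
    lebesguePoisson d =
      Measure.sum fun n : ℕ => ((n.factorial : ℝ≥0∞)⁻¹) • Measure.map (toConf n) volume := by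
  rw [lebesguePoisson]
  congr 1
  funext n
  congr 1
  have h1 : ofTuple (d := d) n = toConf n ∘ Subtype.val := by
    funext x
    exact (toConf_of_injective x.2).symm
  rw [h1, ← Measure.map_map (measurable_toConf n) measurable_subtype_coe,
    show Measure.map Subtype.val (Measure.comap (Subtype.val : Tuple d n → _) volume) = _ from
      map_comap_subtype_coe (measurableSet_injective n) volume]
  congr 1
  exact Measure.restrict_eq_self_of_ae_mem (ae_injective hd n)

theorem lintegral_lebesguePoisson (hd : 0 < d) {f : FinConf d → ℝ≥0∞} (hf : Measurable f) :
    ∫⁻ η, f η ∂(lebesguePoisson d) =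
      ∑' n : ℕ, (n.factorial : ℝ≥0∞)⁻¹ * ∫⁻ x, f (toConf n x) := by
  rw [lebesguePoisson_eq_sum_map hd, lintegral_sum_measure]
  refine tsum_congr fun n => ?_
  rw [lintegral_smul_measure, lintegral_map hf (measurable_toConf n), smul_eq_mul]

instance : SigmaFinite (lebesguePoisson d) := by
  let S : ℕ → Set (FinConf d) := fun N => {η | η.card ≤ N ∧ ∀ x ∈ η.pts, ‖x‖ ≤ N}
  have hpre : ∀ N n, ofTuple (d := d) n ⁻¹' S N =
      Subtype.val ⁻¹' {x : Fin n → EuclideanSpace ℝ (Fin d) | n ≤ N ∧ ∀ i, ‖x i‖ ≤ N} := by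
    intro N n
    ext x
    simp [S, ofTuple, card]
  have hmeas : ∀ N n, MeasurableSet
      {x : Fin n → EuclideanSpace ℝ (Fin d) | n ≤ N ∧ ∀ i, ‖x i‖ ≤ N} := by
    intro N n
    have : {x : Fin n → EuclideanSpace ℝ (Fin d) | n ≤ N ∧ ∀ i, ‖x i‖ ≤ N} =
        {_x | n ≤ N} ∩ ⋂ i, {x | ‖x i‖ ≤ N} := by
      ext x
      simp
    rw [this]
    exact (MeasurableSet.const _).inter (MeasurableSet.iInter fun i =>
      measurableSet_le (measurable_pi_apply i).norm measurable_const)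
  have hS : ∀ N, MeasurableSet (S N) := by
    intro N
    rw [MeasurableSpace.measurableSet_iInf]
    intro n
    change MeasurableSet (ofTuple n ⁻¹' S N)
    rw [hpre]
    exact measurable_subtype_coe (hmeas N n)
  refine ⟨⟨⟨S, fun _ => trivial, fun N => ?_, ?_⟩⟩⟩
  · rw [lebesguePoisson, Measure.sum_apply _ (hS N)]
    have hz : ∀ n ∉ Finset.range (N + 1), ((n.factorial : ℝ≥0∞)⁻¹ • Measure.map (ofTuple n)
        (Measure.comap (Subtype.val : Tuple d n → _) volume)) (S N) = 0 := by
      intro n hn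
      have : ¬ n ≤ N := by simpa using hn
      rw [Measure.smul_apply, Measure.map_apply (measurable_ofTuple n) (hS N), hpre]
      simp [this]
    rw [tsum_eq_sum hz]
    refine ENNReal.sum_lt_top.2 fun n _ => ?_
    rw [Measure.smul_apply, Measure.map_apply (measurable_ofTuple n) (hS N), hpre,
      comap_subtype_coe_apply (measurableSet_injective n), smul_eq_mul]
    refine ENNReal.mul_lt_top (by simp [n.factorial_ne_zero, Nat.pos_iff_ne_zero]) ?_
    refine lt_of_le_of_lt (measure_mono (t := Set.pi Set.univ fun _ : Fin n =>
      Metric.closedBall (0 : EuclideanSpace ℝ (Fin d)) N) ?_) ?_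
    · rintro _ ⟨x, hx, rfl⟩ i _
      simpa using hx.2 i
    · rw [volume_pi_pi]
      exact ENNReal.prod_lt_top fun i _ => measure_closedBall_lt_top
  · refine Set.eq_univ_of_forall fun η => Set.mem_iUnion.2 ?_
    obtain ⟨M, hM⟩ : ∃ M : ℕ, ∀ x ∈ η.pts, ‖x‖ ≤ M := by
      obtain ⟨r, hr⟩ := (η.pts.finite_toSet.image fun x => ‖x‖).bddAbove
      obtain ⟨M, hM⟩ := exists_nat_ge r
      exact ⟨M, fun x hx => (hr ⟨x, hx, rfl⟩).trans hM⟩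
    refine ⟨max η.card M, le_max_left _ _, fun x hx => (hM x hx).trans ?_⟩
    exact_mod_cast le_max_right _ _

instance (C : ℝ) : SigmaFinite (weighted d C) :=
  SigmaFinite.withDensity_of_ne_top' fun _ => ENNReal.pow_ne_top ENNReal.ofReal_ne_top

end FinConf

/-! ### The Mecke formula -/

namespace FinConf

open scoped Classical

variable {d : ℕ}

theorem toConf_insertNth {n : ℕ} {x : Fin n → EuclideanSpace ℝ (Fin d)}
    (hx : Function.Injective x) (i : Fin (n + 1)) {y : EuclideanSpace ℝ (Fin d)}
    (hy : y ∉ Set.range x) :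
    toConf (n + 1) (i.insertNth y x : Fin (n + 1) → EuclideanSpace ℝ (Fin d)) =
      (toConf n x).add y := by
  have hinj : Function.Injective (i.insertNth y x : Fin (n + 1) → EuclideanSpace ℝ (Fin d)) := by
    intro a b
    refine Fin.succAboveCases i ?_ (fun a' => ?_) a <;>
      refine Fin.succAboveCases i ?_ (fun b' => ?_) b
    · simp
    · intro h
      exact absurd ⟨b', by simpa using h.symm⟩ hy
    · intro h
      exact absurd ⟨a', by simpa using h⟩ hy
    · intro h
      have : a' = b' := hx (by simpa using h)
      rw [this]
  ext1
  rw [pts_toConf hinj, add, pts_toConf hx]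
  ext a
  simp only [Finset.mem_image, Finset.mem_univ, true_and, Finset.mem_insert]
  rw [Fin.exists_iff_succAbove i]
  simp [eq_comm]

theorem sum_erase_toConf {R : Type*} [CommSemiring R] {n : ℕ}
    {z : Fin (n + 1) → EuclideanSpace ℝ (Fin d)} (hz : Function.Injective z) (h : FinConf d → R) :
    ∑ x ∈ (toConf (n + 1) z).pts, h ((toConf (n + 1) z).erase x) =
      ∑ i, h (toConf n (Fin.removeNth i z)) := by
  rw [pts_toConf hz, Finset.sum_image hz.injOn]
  refine Finset.sum_congr rfl fun i _ => ?_
  congr 1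
  ext1
  rw [erase, pts_toConf hz,
    pts_toConf (show Function.Injective (i.removeNth z) from hz.comp Fin.succAbove_right_injective)]
  ext a
  simp only [Finset.mem_erase, Finset.mem_image, Finset.mem_univ, true_and]
  rw [Fin.exists_iff_succAbove i]
  constructor
  · rintro ⟨h1, h2 | ⟨j, rfl⟩⟩
    · exact absurd h2.symm h1
    · exact ⟨j, rfl⟩
  · rintro ⟨j, rfl⟩
    exact ⟨fun e => Fin.succAbove_ne i j (hz e), Or.inr ⟨j, rfl⟩⟩

theorem measurable_add_ofTuple (n : ℕ) :
    Measurable fun p : Tuple d n × EuclideanSpace ℝ (Fin d) => (ofTuple n p.1).add p.2 := by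
  have h : (fun p : Tuple d n × EuclideanSpace ℝ (Fin d) => (ofTuple n p.1).add p.2) = fun p =>
      if p ∈ {p : Tuple d n × EuclideanSpace ℝ (Fin d) | ∃ i, p.2 = p.1.1 i} then ofTuple n p.1
      else toConf (n + 1) (Fin.cons p.2 p.1.1) := by
    funext p
    split_ifs with hp
    · obtain ⟨i, hi⟩ := hp
      ext1
      simp [add, ofTuple, hi]
    · rw [← Fin.insertNth_zero', toConf_insertNth p.1.2 _ fun ⟨i, hi⟩ => hp ⟨i, hi.symm⟩,
        toConf_of_injective p.1.2]
  have hs : MeasurableSet {p : Tuple d n × EuclideanSpace ℝ (Fin d) | ∃ i, p.2 = p.1.1 i} := by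
    have : {p : Tuple d n × EuclideanSpace ℝ (Fin d) | ∃ i, p.2 = p.1.1 i} =
        ⋃ i, {p | p.2 = p.1.1 i} := by
      ext
      simp
    rw [this]
    refine MeasurableSet.iUnion fun i => measurableSet_eq_fun measurable_snd ?_
    exact (measurable_pi_apply i).comp (measurable_subtype_coe.comp measurable_fst)
  rw [h]
  refine Measurable.ite hs ((measurable_ofTuple n).comp measurable_fst)
    ((measurable_toConf (n + 1)).comp (measurable_pi_lambda _ fun i => ?_))
  refine Fin.cases ?_ (fun j => ?_) i
  · exact measurable_snd
  · exact (measurable_pi_apply j).comp (measurable_subtype_coe.comp measurable_fst)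

theorem measurable_lintegral_add {g : FinConf d → ℝ≥0∞} (hg : Measurable g) :
    Measurable fun η : FinConf d => ∫⁻ x, g (η.add x) :=
  measurable_iff.2 fun n => (hg.comp (measurable_add_ofTuple n)).lintegral_prod_right'

theorem measurable_integral_add {g : FinConf d → ℝ} (hg : Measurable g) :
    Measurable fun η : FinConf d => ∫ x, g (η.add x) :=
  measurable_iff.2 fun n =>
    ((hg.comp (measurable_add_ofTuple n)).stronglyMeasurable.integral_prod_right').measurable

theorem measurable_add (η : FinConf d) : Measurable fun x => η.add x := by
  have hη : ofTuple η.card ⟨fun i => (η.pts.equivFin.symm i : EuclideanSpace ℝ (Fin d)),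
      Subtype.val_injective.comp η.pts.equivFin.symm.injective⟩ = η := by
    ext1
    ext a
    simp only [ofTuple, Finset.mem_map, Finset.mem_univ, true_and, Function.Embedding.coeFn_mk]
    exact ⟨by rintro ⟨i, rfl⟩; exact (η.pts.equivFin.symm i).2,
      fun ha => ⟨η.pts.equivFin ⟨a, ha⟩, by simp⟩⟩
  have := (measurable_add_ofTuple (d := d) η.card).comp
    (measurable_prodMk_left (x := (⟨fun i => (η.pts.equivFin.symm i : EuclideanSpace ℝ (Fin d)),
      Subtype.val_injective.comp η.pts.equivFin.symm.injective⟩ : Tuple d η.card)))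
  simpa only [Function.comp_def, hη] using this

theorem measurable_sum_erase {R : Type*} [CommSemiring R] [MeasurableSpace R] [MeasurableAdd₂ R]
    [MeasurableMul₂ R] {h : FinConf d → R} (hh : Measurable h) :
    Measurable fun η : FinConf d => ∑ x ∈ η.pts, h (η.erase x) := by
  have := measurable_subsetSum (fun _ j => if j = 1 then (1 : R) else 0) hh
  simpa only [funext fun η : FinConf d => (subsetSum_single (1 : R) h η).trans (one_mul _)]
    using this

/-- In coordinates both sides are integrals over `(n + 1)`-tuples: on the right, each of the
`n + 1` choices of the deleted point contributes the same amount, which turns the factor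
`1 / (n + 1)!` into `1 / n!`. -/
theorem lintegral_add_mul (hd : 0 < d) {g h : FinConf d → ℝ≥0∞} (hg : Measurable g)
    (hh : Measurable h) :
    ∫⁻ η, (∫⁻ x, g (η.add x)) * h η ∂(lebesguePoisson d) =
      ∫⁻ η, g η * ∑ x ∈ η.pts, h (η.erase x) ∂(lebesguePoisson d) := by
  have : NeZero d := ⟨hd.ne'⟩
  rw [lintegral_lebesguePoisson hd (f := fun η => (∫⁻ x, g (η.add x)) * h η)
      ((measurable_lintegral_add hg).mul hh),
    lintegral_lebesguePoisson hd (f := fun η => g η * ∑ x ∈ η.pts, h (η.erase x))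
      (hg.mul (measurable_sum_erase hh))]
  conv_rhs => rw [tsum_eq_zero_add' ENNReal.summable]
  have h0 : ∫⁻ z : Fin 0 → EuclideanSpace ℝ (Fin d), g (toConf 0 z) *
      ∑ x ∈ (toConf 0 z).pts, h ((toConf 0 z).erase x) = 0 := by
    refine (lintegral_congr fun z => ?_).trans lintegral_zero
    rw [pts_toConf (Function.injective_of_subsingleton z)]
    simp
  rw [h0, mul_zero, zero_add]
  refine tsum_congr fun n => ?_
  have hterm : ∀ i : Fin (n + 1), ∫⁻ z : Fin (n + 1) → EuclideanSpace ℝ (Fin d),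
      g (toConf (n + 1) z) * h (toConf n (i.removeNth z)) =
        ∫⁻ x, (∫⁻ y, g ((toConf n x).add y)) * h (toConf n x) := by
    intro i
    have hp := (volume_preserving_piFinSuccAbove
      (fun _ : Fin (n + 1) => EuclideanSpace ℝ (Fin d)) i).symm
    have hmeas : Measurable fun z : Fin (n + 1) → EuclideanSpace ℝ (Fin d) =>
        g (toConf (n + 1) z) * h (toConf n (i.removeNth z)) :=
      (hg.comp (measurable_toConf _)).mul (hh.comp ((measurable_toConf n).comp
        (measurable_pi_lambda _ fun j => measurable_pi_apply _)))
    rw [← hp.lintegral_comp hmeas, Measure.volume_eq_prod]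
    refine (lintegral_prod_symm' _ (hmeas.comp hp.measurable)).trans ?_
    refine lintegral_congr_ae ?_
    filter_upwards [ae_injective hd n] with x hx
    refine Eq.trans ?_ (lintegral_mul_const (h (toConf n x))
      (hg.comp (measurable_add (toConf n x))))
    refine lintegral_congr_ae ?_
    filter_upwards [measure_eq_zero_iff_ae_notMem.1 ((Set.finite_range x).measure_zero volume)]
      with y hy
    change g (toConf (n + 1) (i.insertNth y x : Fin (n + 1) → EuclideanSpace ℝ (Fin d))) *
      h (toConf n (i.removeNth (i.insertNth y x : Fin (n + 1) → EuclideanSpace ℝ (Fin d)))) = _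
    rw [Fin.removeNth_insertNth, toConf_insertNth hx i hy]
  have hsum : ∫⁻ z : Fin (n + 1) → EuclideanSpace ℝ (Fin d), g (toConf (n + 1) z) *
      ∑ x ∈ (toConf (n + 1) z).pts, h ((toConf (n + 1) z).erase x) =
        ∑ i : Fin (n + 1), ∫⁻ z : Fin (n + 1) → EuclideanSpace ℝ (Fin d),
          g (toConf (n + 1) z) * h (toConf n (i.removeNth z)) := by
    rw [← lintegral_finsetSum _ fun i _ => ?_]
    · refine lintegral_congr_ae ?_
      filter_upwards [ae_injective hd (n + 1)] with z hz
      rw [sum_erase_toConf hz, Finset.mul_sum]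
    · exact (hg.comp (measurable_toConf _)).mul (hh.comp ((measurable_toConf n).comp
        (measurable_pi_lambda _ fun j => measurable_pi_apply _)))
  rw [hsum, Finset.sum_congr rfl fun i _ => hterm i, Finset.sum_const, Finset.card_univ,
    Fintype.card_fin, nsmul_eq_mul, ← mul_assoc, Nat.factorial_succ, Nat.cast_mul,
    ENNReal.mul_inv (by simp) (by simp), mul_right_comm _ _ ((n + 1 : ℕ) : ℝ≥0∞),
    ENNReal.inv_mul_cancel (by simp) (by simp), one_mul]

/-- Adding a point: a `λ`-null set is avoided by `η ∪ {x}` for almost all `η` and `x`. -/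
theorem ae_add (hd : 0 < d) {P : FinConf d → Prop} (h : ∀ᵐ η ∂(lebesguePoisson d), P η) :
    ∀ᵐ η ∂(lebesguePoisson d), ∀ᵐ x, P (η.add x) := by
  obtain ⟨N, hN, hNm, hN0⟩ := exists_measurable_superset_of_null (ae_iff.1 h)
  have hi : Measurable (N.indicator (1 : FinConf d → ℝ≥0∞)) := measurable_one.indicator hNm
  have h1 := lintegral_add_mul hd hi (measurable_const (a := (1 : ℝ≥0∞)))
  have h2 : ∫⁻ η, N.indicator 1 η * ∑ x ∈ η.pts, (1 : ℝ≥0∞) ∂(lebesguePoisson d) = 0 := by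
    refine lintegral_eq_zero_of_ae_eq_zero ?_
    filter_upwards [measure_eq_zero_iff_ae_notMem.1 hN0] with η hη
    simp [hη]
  rw [h2, lintegral_eq_zero_iff (by simpa using measurable_lintegral_add hi)] at h1
  filter_upwards [h1] with η hη
  simp only [mul_one, Pi.zero_apply] at hη
  rw [lintegral_eq_zero_iff (f := fun x => N.indicator 1 (η.add x))
    (hi.comp (measurable_add η))] at hη
  filter_upwards [hη] with x hx
  by_contra hP
  have : η.add x ∈ N := hN hP
  simp [this] at hx

theorem ae_erase (hd : 0 < d) {P : FinConf d → Prop} (h : ∀ᵐ η ∂(lebesguePoisson d), P η) :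
    ∀ᵐ η ∂(lebesguePoisson d), ∀ x ∈ η.pts, P (η.erase x) := by
  obtain ⟨N, hN, hNm, hN0⟩ := exists_measurable_superset_of_null (ae_iff.1 h)
  have hi : Measurable (N.indicator (1 : FinConf d → ℝ≥0∞)) := measurable_one.indicator hNm
  have h1 := lintegral_add_mul hd (measurable_const (a := (1 : ℝ≥0∞))) hi
  have h2 : ∫⁻ η : FinConf d, (∫⁻ _ : EuclideanSpace ℝ (Fin d), (1 : ℝ≥0∞)) *
      N.indicator 1 η ∂(lebesguePoisson d) = 0 := by
    refine lintegral_eq_zero_of_ae_eq_zero ?_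
    filter_upwards [measure_eq_zero_iff_ae_notMem.1 hN0] with η hη
    simp [hη]
  rw [h2, eq_comm, lintegral_eq_zero_iff (by simpa using measurable_sum_erase hi)] at h1
  filter_upwards [h1] with η hη x hx
  simp only [one_mul, Pi.zero_apply, Finset.sum_eq_zero_iff] at hη
  by_contra hP
  have : η.erase x ∈ N := hN hP
  simpa [this] using hη x hx

/-- Subconfigurations of almost every configuration avoid a given `λ`-null set: delete the points
one at a time. -/
theorem ae_subset (hd : 0 < d) {P : FinConf d → Prop} (h : ∀ᵐ η ∂(lebesguePoisson d), P η) :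
    ∀ᵐ η ∂(lebesguePoisson d), ∀ ζ ∈ η.pts.powerset, P ⟨ζ⟩ := by
  have key : ∀ j : ℕ, ∀ᵐ η ∂(lebesguePoisson d),
      ∀ ζ ⊆ η.pts, (η.pts \ ζ).card = j → P ⟨ζ⟩ := by
    intro j
    induction j with
    | zero =>
      filter_upwards [h] with η hη ζ hζ hc
      have : ζ = η.pts :=
        hζ.antisymm (Finset.sdiff_eq_empty_iff_subset.1 (Finset.card_eq_zero.1 hc))
      rwa [this]
    | succ j ih =>
      filter_upwards [ae_erase hd ih] with η hη ζ hζ hc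
      obtain ⟨x, hx⟩ : (η.pts \ ζ).Nonempty := Finset.card_pos.1 (by omega)
      have hx' := Finset.mem_sdiff.1 hx
      refine hη x hx'.1 ζ (Finset.subset_erase.2 ⟨hζ, hx'.2⟩) ?_
      rw [erase, Finset.erase_sdiff_comm, Finset.card_erase_of_mem hx, hc]
      rfl
  filter_upwards [ae_all_iff.2 key] with η hη ζ hζ
  exact hη _ ζ (Finset.mem_powerset.1 hζ) rfl

end FinConf

/-! ### The action of a sub-Markov kernel on `L¹` -/

namespace MeasureTheory

variable {α : Type*} [MeasurableSpace α] {μ : Measure α}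

theorem measurable_coe_Lp (G : Lp ℝ 1 μ) : Measurable G :=
  (Lp.stronglyMeasurable G).measurable

theorem integrable_coe_Lp (G : Lp ℝ 1 μ) : Integrable G μ :=
  memLp_one_iff_integrable.1 (Lp.memLp G)

theorem norm_Lp_one_le_of_forall_integral_mul_le {F : Lp ℝ 1 μ} {b : ℝ}
    (hb : ∀ h : α → ℝ, Measurable h → (∀ x, |h x| ≤ 1) → ∫ x, F x * h x ∂μ ≤ b) : ‖F‖ ≤ b := by
  classical
  have hm : Measurable fun x => if 0 ≤ F x then (1 : ℝ) else -1 :=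
    Measurable.ite (measurableSet_le measurable_const (measurable_coe_Lp F)) measurable_const
      measurable_const
  refine le_trans (le_of_eq ?_) (hb _ hm fun x => ?_)
  · rw [L1.norm_eq_integral_norm]
    refine integral_congr_ae (Eventually.of_forall fun x => ?_)
    dsimp only
    split_ifs with h
    · simp [abs_of_nonneg h]
    · simp [abs_of_neg (not_le.1 h)]
  · split_ifs <;> simp

theorem Lp_one_ext {F F' : Lp ℝ 1 μ}
    (h : ∀ h : α → ℝ, Measurable h → (∀ x, |h x| ≤ 1) →
      ∫ x, F x * h x ∂μ = ∫ x, F' x * h x ∂μ) : F = F' := by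
  rw [← sub_eq_zero, ← norm_le_zero_iff]
  refine norm_Lp_one_le_of_forall_integral_mul_le fun k hk hk1 => le_of_eq ?_
  have hi : ∀ F : Lp ℝ 1 μ, Integrable (fun x => F x * k x) μ := fun F =>
    (integrable_coe_Lp F).mul_bdd hk.aestronglyMeasurable (c := 1) (Eventually.of_forall hk1)
  rw [← sub_eq_zero.2 (h k hk hk1), ← integral_sub (hi F) (hi F')]
  refine integral_congr_ae ?_
  filter_upwards [Lp.coeFn_sub F F'] with x hx
  rw [hx, Pi.sub_apply, sub_mul]

theorem abs_integral_le_one {ν : Measure α} (hν : ν Set.univ ≤ 1) {h : α → ℝ}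
    (hb : ∀ x, |h x| ≤ 1) : |∫ y, h y ∂ν| ≤ 1 := by
  have : IsFiniteMeasure ν := ⟨hν.trans_lt ENNReal.one_lt_top⟩
  have h1 := norm_integral_le_of_norm_le_const (μ := ν) (f := h) (C := 1) (Eventually.of_forall hb)
  refine h1.trans ?_
  simpa [measureReal_def] using ENNReal.toReal_mono ENNReal.one_ne_top hν

open ProbabilityTheory

/-- The image of a density under a kernel that preserves null sets has a density. -/
theorem exists_density_comp [SigmaFinite μ] (κ : Kernel α α) [IsFiniteKernel κ]
    (hκ : ∀ s, MeasurableSet s → μ s = 0 → ∀ᵐ x ∂μ, κ x s = 0) {φ : α → ℝ≥0∞}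
    (hφi : ∫⁻ x, φ x ∂μ ≠ ∞) :
    ∃ r : α → ℝ≥0∞, Measurable r ∧ (∀ᵐ x ∂μ, r x < ∞) ∧
      μ.withDensity r = (μ.withDensity φ).bind κ := by
  have : IsFiniteMeasure (μ.withDensity φ) := isFiniteMeasure_withDensity hφi
  have hac : (μ.withDensity φ).bind κ ≪ μ := by
    refine Measure.AbsolutelyContinuous.mk fun s hs h0 => ?_
    rw [Measure.bind_apply hs κ.aemeasurable]
    exact lintegral_eq_zero_of_ae_eq_zero
      ((withDensity_absolutelyContinuous μ φ).ae_le (hκ s hs h0))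
  exact ⟨_, Measure.measurable_rnDeriv _ _, Measure.rnDeriv_lt_top _ _,
    Measure.withDensity_rnDeriv_eq _ _ hac⟩

theorem exists_Lp_one_comp [SigmaFinite μ] (κ : Kernel α α) (hκ1 : ∀ x, κ x Set.univ ≤ 1)
    (hκ : ∀ s, MeasurableSet s → μ s = 0 → ∀ᵐ x ∂μ, κ x s = 0) (G : Lp ℝ 1 μ) :
    ∃ F : Lp ℝ 1 μ,
      (∀ h : α → ℝ, Measurable h → (∀ x, |h x| ≤ 1) →
        ∫ x, F x * h x ∂μ = ∫ x, G x * ∫ y, h y ∂(κ x) ∂μ) ∧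
      ∀ f : α → ℝ≥0∞, Measurable f →
        ∫⁻ x, f x * ‖F x‖ₑ ∂μ ≤ ∫⁻ x, (∫⁻ y, f y ∂(κ x)) * ‖G x‖ₑ ∂μ := by
  have : IsFiniteKernel κ := ⟨1, by simp, hκ1⟩
  have hGm := measurable_coe_Lp G
  have hGi := integrable_coe_Lp G
  have half : ∀ φ : α → ℝ, Measurable φ → Integrable φ μ → (∀ x, 0 ≤ φ x) →
      ∃ r : α → ℝ≥0∞, Measurable r ∧ (∀ᵐ x ∂μ, r x < ∞) ∧
        (∀ f : α → ℝ≥0∞, Measurable f →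
          ∫⁻ x, f x * r x ∂μ = ∫⁻ x, (∫⁻ y, f y ∂(κ x)) * ENNReal.ofReal (φ x) ∂μ) ∧
        ∀ h : α → ℝ, Measurable h → (∀ x, |h x| ≤ 1) →
          ∫ x, (r x).toReal * h x ∂μ = ∫ x, φ x * ∫ y, h y ∂(κ x) ∂μ := by
    intro φ hφ hφi hφ0
    have hφf : ∫⁻ x, ENNReal.ofReal (φ x) ∂μ ≠ ∞ := hφi.lintegral_lt_top.ne
    have hfin : IsFiniteMeasure (μ.withDensity fun x => ENNReal.ofReal (φ x)) :=
      isFiniteMeasure_withDensity hφf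
    obtain ⟨r, hr, hrf, e⟩ := exists_density_comp κ hκ hφf
    refine ⟨r, hr, hrf, fun f hf => ?_, fun h hh hb => ?_⟩
    · calc ∫⁻ x, f x * r x ∂μ = ∫⁻ x, f x ∂(μ.withDensity r) := by
            rw [lintegral_withDensity_eq_lintegral_mul _ hr hf]
            simp [mul_comm]
        _ = _ := by
            rw [e, Measure.lintegral_bind κ.aemeasurable hf.aemeasurable,
              lintegral_withDensity_eq_lintegral_mul _ hφ.ennreal_ofReal hf.lintegral_kernel]
            simp [mul_comm]
    · have hint : Integrable h ((μ.withDensity fun x => ENNReal.ofReal (φ x)).bind κ) :=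
        Integrable.of_bound hh.aestronglyMeasurable 1 (Eventually.of_forall hb)
      calc ∫ x, (r x).toReal * h x ∂μ = ∫ x, h x ∂(μ.withDensity r) :=
            (integral_withDensity_eq_integral_toReal_smul hr hrf h).symm
        _ = ∫ x, ∫ y, h y ∂(κ x) ∂(μ.withDensity fun x => ENNReal.ofReal (φ x)) := by
            rw [e]
            rw [Measure.comp_eq_comp_const_apply] at hint ⊢
            rw [Kernel.integral_comp hint]
            simp
        _ = _ := by
            rw [integral_withDensity_eq_integral_toReal_smul hφ.ennreal_ofReal (by simp)]
            simp [ENNReal.toReal_ofReal (hφ0 _)]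
  obtain ⟨r, hr, hrf, hr1, hr2⟩ := half (fun x => max (G x) 0) (hGm.max measurable_const)
    hGi.pos_part fun x => le_max_right _ _
  obtain ⟨s, hs, hsf, hs1, hs2⟩ := half (fun x => max (-G x) 0) (hGm.neg.max measurable_const)
    hGi.neg_part fun x => le_max_right _ _
  have hri : Integrable (fun x => (r x).toReal) μ := by
    refine integrable_toReal_of_lintegral_ne_top hr.aemeasurable ?_
    have := hr1 (fun _ => 1) measurable_const
    simp only [one_mul, lintegral_one] at this
    rw [this]
    refine ne_top_of_le_ne_top hGi.pos_part.lintegral_lt_top.ne (lintegral_mono fun x => ?_)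
    exact mul_le_of_le_one_left' (hκ1 x)
  have hsi : Integrable (fun x => (s x).toReal) μ := by
    refine integrable_toReal_of_lintegral_ne_top hs.aemeasurable ?_
    have := hs1 (fun _ => 1) measurable_const
    simp only [one_mul, lintegral_one] at this
    rw [this]
    refine ne_top_of_le_ne_top hGi.neg_part.lintegral_lt_top.ne (lintegral_mono fun x => ?_)
    exact mul_le_of_le_one_left' (hκ1 x)
  obtain ⟨F, hF⟩ : ∃ F : Lp ℝ 1 μ, F =ᵐ[μ] fun x => (r x).toReal - (s x).toReal :=
    ⟨(hri.sub hsi).toL1 _, (hri.sub hsi).coeFn_toL1⟩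
  refine ⟨F, fun h hh hb => ?_, fun f hf => ?_⟩
  · have hκh : ∀ x, |∫ y, h y ∂(κ x)| ≤ 1 := fun x => abs_integral_le_one (hκ1 x) hb
    have hκm : StronglyMeasurable fun x => ∫ y, h y ∂(κ x) := hh.stronglyMeasurable.integral_kernel
    have hmul : ∀ (φ k : α → ℝ), Integrable φ μ → AEStronglyMeasurable k μ → (∀ x, |k x| ≤ 1) →
        Integrable (fun x => φ x * k x) μ := fun φ k hφ hk hk1 =>
      hφ.mul_bdd hk (c := 1) (Eventually.of_forall hk1)
    calc ∫ x, F x * h x ∂μ = ∫ x, ((r x).toReal * h x - (s x).toReal * h x) ∂μ := by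
          refine integral_congr_ae ?_
          filter_upwards [hF] with x hx
          rw [hx, ← sub_mul]
      _ = ∫ x, (max (G x) 0 * ∫ y, h y ∂(κ x)) - (max (-G x) 0 * ∫ y, h y ∂(κ x)) ∂μ := by
          rw [integral_sub (hmul _ _ hri hh.aestronglyMeasurable hb)
              (hmul _ _ hsi hh.aestronglyMeasurable hb), hr2 h hh hb, hs2 h hh hb,
            integral_sub (hmul _ _ hGi.pos_part hκm.aestronglyMeasurable hκh)
              (hmul _ _ hGi.neg_part hκm.aestronglyMeasurable hκh)]
      _ = _ := by
          refine integral_congr_ae (Eventually.of_forall fun x => ?_)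
          dsimp only
          rw [← sub_mul]
          congr 1
          rcases le_total 0 (G x) with h | h <;> simp [h]
  · calc ∫⁻ x, f x * ‖F x‖ₑ ∂μ ≤ ∫⁻ x, (f x * r x + f x * s x) ∂μ := by
          refine lintegral_mono_ae ?_
          filter_upwards [hF] with x hx
          rw [hx, ← mul_add]
          gcongr
          refine enorm_sub_le.trans (add_le_add ?_ ?_)
          · rw [Real.enorm_of_nonneg ENNReal.toReal_nonneg]
            exact ENNReal.ofReal_toReal_le
          · rw [Real.enorm_of_nonneg ENNReal.toReal_nonneg]
            exact ENNReal.ofReal_toReal_le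
      _ = _ := by
          rw [lintegral_add_left (f := fun x => f x * r x) (hf.mul hr), hr1 f hf, hs1 f hf,
            ← lintegral_add_left
              (f := fun x => (∫⁻ y, f y ∂(κ x)) * ENNReal.ofReal (max (G x) 0))
              (hf.lintegral_kernel.mul
              (hGm.max measurable_const).ennreal_ofReal)]
          refine lintegral_congr fun x => ?_
          rw [← mul_add]
          congr 1
          rcases le_total 0 (G x) with h | h
          · simp [h, Real.enorm_eq_ofReal_abs, abs_of_nonneg h]
          · simp [h, Real.enorm_eq_ofReal_abs, abs_of_nonpos h]

/-- A sub-Markov kernel that does not charge `μ`-null sets acts on `L¹(μ)` by transporting the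
signed measures `G μ`; this action is the predual of the action `h ↦ ∫ h dκ` on bounded
functions. -/
theorem exists_predual [SigmaFinite μ] (κ : Kernel α α) (hκ1 : ∀ x, κ x Set.univ ≤ 1)
    (hκ : ∀ s, MeasurableSet s → μ s = 0 → ∀ᵐ x ∂μ, κ x s = 0) :
    ∃ T : Lp ℝ 1 μ →L[ℝ] Lp ℝ 1 μ, ‖T‖ ≤ 1 ∧
      (∀ G (h : α → ℝ), Measurable h → (∀ x, |h x| ≤ 1) →
        ∫ x, T G x * h x ∂μ = ∫ x, G x * ∫ y, h y ∂(κ x) ∂μ) ∧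
      ∀ G (f : α → ℝ≥0∞), Measurable f →
        ∫⁻ x, f x * ‖T G x‖ₑ ∂μ ≤ ∫⁻ x, (∫⁻ y, f y ∂(κ x)) * ‖G x‖ₑ ∂μ := by
  have : IsFiniteKernel κ := ⟨1, by simp, hκ1⟩
  choose T hT1 hT2 using exists_Lp_one_comp (μ := μ) κ hκ1 hκ
  have hκh : ∀ h : α → ℝ, (∀ x, |h x| ≤ 1) → ∀ x, |∫ y, h y ∂(κ x)| ≤ 1 :=
    fun h hb x => abs_integral_le_one (hκ1 x) hb
  have hi : ∀ (F : Lp ℝ 1 μ) (k : α → ℝ), Measurable k → (∀ x, |k x| ≤ 1) →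
      Integrable (fun x => F x * k x) μ := fun F k hk hk1 =>
    (integrable_coe_Lp F).mul_bdd hk.aestronglyMeasurable (c := 1) (Eventually.of_forall hk1)
  have hadd : ∀ (F F' : Lp ℝ 1 μ) (k : α → ℝ), Measurable k → (∀ x, |k x| ≤ 1) →
      ∫ x, (F + F') x * k x ∂μ = ∫ x, F x * k x ∂μ + ∫ x, F' x * k x ∂μ := by
    intro F F' k hk hk1
    rw [← integral_add (hi F k hk hk1) (hi F' k hk hk1)]
    refine integral_congr_ae ?_
    filter_upwards [Lp.coeFn_add F F'] with x hx
    rw [hx, Pi.add_apply, add_mul]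
  have hsmul : ∀ (c : ℝ) (F : Lp ℝ 1 μ) (k : α → ℝ),
      ∫ x, (c • F) x * k x ∂μ = c * ∫ x, F x * k x ∂μ := by
    intro c F k
    rw [← integral_const_mul]
    refine integral_congr_ae ?_
    filter_upwards [Lp.coeFn_smul c F] with x hx
    rw [hx, Pi.smul_apply, smul_eq_mul, mul_assoc]
  have hm : ∀ h : α → ℝ, Measurable h → Measurable fun x => ∫ y, h y ∂(κ x) := fun h hh =>
    hh.stronglyMeasurable.integral_kernel.measurable
  let L : Lp ℝ 1 μ →ₗ[ℝ] Lp ℝ 1 μ :=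
    { toFun := T
      map_add' := fun G G' => Lp_one_ext fun h hh hb => by
        rw [hT1 _ h hh hb, hadd _ _ _ (hm h hh) (hκh h hb), hadd _ _ _ hh hb, hT1 _ h hh hb,
          hT1 _ h hh hb]
      map_smul' := fun c G => Lp_one_ext fun h hh hb => by
        rw [hT1 _ h hh hb, RingHom.id_apply, hsmul, hsmul, hT1 _ h hh hb] }
  have hbound : ∀ G, ‖L G‖ ≤ 1 * ‖G‖ := by
    intro G
    rw [one_mul]
    refine norm_Lp_one_le_of_forall_integral_mul_le fun h hh hb => ?_
    change ∫ x, T G x * h x ∂μ ≤ _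
    rw [hT1 G h hh hb, L1.norm_eq_integral_norm]
    refine integral_mono (hi G _ (hm h hh) (hκh h hb)) (integrable_coe_Lp G).norm fun x => ?_
    refine (le_abs_self _).trans ?_
    rw [abs_mul]
    exact mul_le_of_le_one_right (abs_nonneg _) (hκh h hb x)
  exact ⟨L.mkContinuous 1 hbound, L.mkContinuous_norm_le zero_le_one hbound, hT1, hT2⟩

end MeasureTheory

/-! ### Independent thinning of configurations -/

namespace FinConf

open scoped Classical

variable {d : ℕ}

theorem subsetSum_const_pow {R : Type*} [CommSemiring R] (p q a : R) (η : FinConf d) :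
    subsetSum (fun k j => p ^ k * q ^ j) (fun ζ => a ^ ζ.card) η = (p * a + q) ^ η.card := by
  rw [card, ← Finset.sum_pow_mul_eq_add_pow, subsetSum]
  refine Finset.sum_congr rfl fun ζ hζ => ?_
  rw [Finset.card_sdiff_of_subset (Finset.mem_powerset.1 hζ), mul_pow]
  simp only [card]
  ring

/-- Only `ζ = η` contributes when no point may be deleted. -/
theorem subsetSum_zero {R : Type*} [CommSemiring R] (a : ℕ → R) (h : FinConf d → R)
    (η : FinConf d) :
    subsetSum (fun k j => if j = 0 then a k else 0) h η = a η.card * h η := by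
  rw [subsetSum, Finset.sum_eq_single_of_mem η.pts (Finset.mem_powerset_self _)]
  · simp [card]
  · intro ζ hζ hne
    rw [if_neg, zero_mul]
    intro h0
    exact hne ((Finset.mem_powerset.1 hζ).antisymm
      (Finset.sdiff_eq_empty_iff_subset.1 (Finset.card_eq_zero.1 h0)))

theorem subsetSum_add {R : Type*} [CommSemiring R] (W W' : ℕ → ℕ → R) (h : FinConf d → R)
    (η : FinConf d) :
    subsetSum (fun k j => W k j + W' k j) h η = subsetSum W h η + subsetSum W' h η := by
  simp only [subsetSum, add_mul, Finset.sum_add_distrib]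

theorem subsetSum_sub (W W' : ℕ → ℕ → ℝ) (h : FinConf d → ℝ) (η : FinConf d) :
    subsetSum (fun k j => W k j - W' k j) h η = subsetSum W h η - subsetSum W' h η := by
  simp only [subsetSum, sub_mul, Finset.sum_sub_distrib]

theorem subsetSum_const_mul {R : Type*} [CommSemiring R] (c : R) (W : ℕ → ℕ → R)
    (h : FinConf d → R) (η : FinConf d) :
    subsetSum (fun k j => c * W k j) h η = c * subsetSum W h η := by
  simp only [subsetSum, Finset.mul_sum, mul_assoc]

theorem abs_subsetSum_le (W : ℕ → ℕ → ℝ) {h : FinConf d → ℝ} (hb : ∀ η, |h η| ≤ 1)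
    (η : FinConf d) : |subsetSum W h η| ≤ subsetSum (fun k j => |W k j|) (fun _ => 1) η := by
  refine (Finset.abs_sum_le_sum_abs _ _).trans (Finset.sum_le_sum fun ζ _ => ?_)
  rw [abs_mul]
  exact mul_le_mul_of_nonneg_left (hb _) (abs_nonneg _)

theorem subsetSum_le_subsetSum {W W' : ℕ → ℕ → ℝ} (hW : ∀ k j, W k j ≤ W' k j) (η : FinConf d) :
    subsetSum W (fun _ => 1) η ≤ subsetSum W' (fun _ => 1) η :=
  Finset.sum_le_sum fun ζ _ => by simpa using hW _ _

theorem subsetSum_insert {R : Type*} [CommSemiring R] (p q : R) (h : FinConf d → R)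
    {a : EuclideanSpace ℝ (Fin d)} {s : Finset (EuclideanSpace ℝ (Fin d))} (ha : a ∉ s) :
    subsetSum (fun k j => p ^ k * q ^ j) h ⟨insert a s⟩ =
      q * subsetSum (fun k j => p ^ k * q ^ j) h ⟨s⟩ +
        p * subsetSum (fun k j => p ^ k * q ^ j) (fun ζ => h (ζ.add a)) ⟨s⟩ := by
  simp only [subsetSum, Finset.sum_powerset_insert ha, Finset.mul_sum]
  congr 1
  · refine Finset.sum_congr rfl fun ζ hζ => ?_
    have haζ : a ∉ ζ := fun h => ha (Finset.mem_powerset.1 hζ h)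
    rw [Finset.insert_sdiff_of_notMem _ haζ,
      Finset.card_insert_of_notMem fun h => ha (Finset.mem_sdiff.1 h).1]
    ring
  · refine Finset.sum_congr rfl fun ζ hζ => ?_
    have haζ : a ∉ ζ := fun h => ha (Finset.mem_powerset.1 hζ h)
    rw [Finset.card_insert_of_notMem haζ, Finset.insert_sdiff_insert,
      Finset.sdiff_insert_of_notMem ha, add]
    ring

/-- Two successive thinnings form one thinning. -/
theorem subsetSum_subsetSum (p q p' q' : ℝ) (h : FinConf d → ℝ) (η : FinConf d) :
    subsetSum (fun k j => p ^ k * q ^ j) (subsetSum (fun k j => p' ^ k * q' ^ j) h) η =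
      subsetSum (fun k j => (p * p') ^ k * (p * q' + q) ^ j) h η := by
  obtain ⟨s⟩ := η
  induction s using Finset.induction_on generalizing h with
  | empty => simp [subsetSum]
  | insert a s ha ih =>
    have e : subsetSum (fun k j => p ^ k * q ^ j)
        (fun ζ => subsetSum (fun k j => p' ^ k * q' ^ j) h (ζ.add a)) ⟨s⟩ =
        q' * subsetSum (fun k j => p ^ k * q ^ j) (subsetSum (fun k j => p' ^ k * q' ^ j) h) ⟨s⟩ +
        p' * subsetSum (fun k j => p ^ k * q ^ j)
          (subsetSum (fun k j => p' ^ k * q' ^ j) fun ζ => h (ζ.add a)) ⟨s⟩ := by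
      conv_lhs => rw [subsetSum]
      rw [subsetSum, subsetSum, Finset.mul_sum, Finset.mul_sum, ← Finset.sum_add_distrib]
      refine Finset.sum_congr rfl fun ζ hζ => ?_
      have haζ : a ∉ ζ := fun h => ha (Finset.mem_powerset.1 hζ h)
      rw [add, subsetSum_insert _ _ _ haζ]
      ring
    rw [subsetSum_insert _ _ _ ha, subsetSum_insert _ _ _ ha, e, ih, ih]
    ring

open ProbabilityTheory in
/-- The kernel that keeps each point with weight `p` and deletes it with weight `q`. -/
noncomputable def thinKernel (d : ℕ) (p q : ℝ≥0∞) : Kernel (FinConf d) (FinConf d) where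
  toFun η := ∑ ζ ∈ η.pts.powerset,
    (p ^ ζ.card * q ^ (η.pts \ ζ).card) • Measure.dirac (⟨ζ⟩ : FinConf d)
  measurable' := by
    refine Measure.measurable_of_measurable_coe _ fun s hs => ?_
    have := measurable_subsetSum (fun k j => p ^ k * q ^ j)
      (measurable_one.indicator hs : Measurable (s.indicator (1 : FinConf d → ℝ≥0∞)))
    convert this using 1
    funext η
    simp [subsetSum, Measure.dirac_apply' _ hs]

theorem lintegral_thinKernel (p q : ℝ≥0∞) {f : FinConf d → ℝ≥0∞} (hf : Measurable f)
    (η : FinConf d) :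
    ∫⁻ ζ, f ζ ∂(thinKernel d p q η) = subsetSum (fun k j => p ^ k * q ^ j) f η := by
  change ∫⁻ ζ, f ζ ∂(∑ ζ ∈ η.pts.powerset,
    (p ^ ζ.card * q ^ (η.pts \ ζ).card) • Measure.dirac (⟨ζ⟩ : FinConf d)) = _
  simp [lintegral_finsetSum_measure, lintegral_dirac' _ hf, subsetSum]

theorem integral_thinKernel {p q : ℝ} (hp : 0 ≤ p) (hq : 0 ≤ q) {h : FinConf d → ℝ}
    (hh : Measurable h) (hb : ∀ η, |h η| ≤ 1) (η : FinConf d) :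
    ∫ ζ, h ζ ∂(thinKernel d (ENNReal.ofReal p) (ENNReal.ofReal q) η) =
      subsetSum (fun k j => p ^ k * q ^ j) h η := by
  change ∫ ζ, h ζ ∂(∑ ζ ∈ η.pts.powerset, (ENNReal.ofReal p ^ ζ.card *
    ENNReal.ofReal q ^ (η.pts \ ζ).card) • Measure.dirac (⟨ζ⟩ : FinConf d)) = _
  rw [integral_finsetSum_measure]
  · simp [integral_dirac' _ _ hh.stronglyMeasurable, subsetSum, hp, hq]
  · intro ζ _
    refine Integrable.smul_measure ?_ (ENNReal.mul_ne_top (by simp) (by simp))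
    exact Integrable.of_bound hh.aestronglyMeasurable 1 (Eventually.of_forall hb)

theorem thinKernel_univ_le {p q : ℝ≥0∞} (h : p + q ≤ 1) (η : FinConf d) :
    thinKernel d p q η Set.univ ≤ 1 := by
  rw [← lintegral_one, lintegral_thinKernel p q (f := fun _ => 1) measurable_const]
  have := subsetSum_const_pow p q 1 η
  simp only [one_pow, mul_one] at this
  exact (le_of_eq this).trans (pow_le_one₀ zero_le h)

theorem ae_weighted_iff {C : ℝ} (hC : 0 < C) {P : FinConf d → Prop} :
    (∀ᵐ η ∂(weighted d C), P η) ↔ ∀ᵐ η ∂(lebesguePoisson d), P η := by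
  rw [weighted, ae_withDensity_iff (measurable_const.pow measurable_card)]
  simp [hC]

theorem thinKernel_null (hd : 0 < d) {C : ℝ} (hC : 0 < C) (p q : ℝ≥0∞) {s : Set (FinConf d)}
    (hs : MeasurableSet s) (h0 : weighted d C s = 0) :
    ∀ᵐ η ∂(weighted d C), thinKernel d p q η s = 0 := by
  have h1 := ae_subset hd ((ae_weighted_iff hC).1 (measure_eq_zero_iff_ae_notMem.1 h0))
  filter_upwards [(ae_weighted_iff hC).2 h1] with η hη
  have : thinKernel d p q η s = ∫⁻ ζ, s.indicator 1 ζ ∂(thinKernel d p q η) :=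
    (lintegral_indicator_one hs).symm
  rw [this, lintegral_thinKernel _ _ (measurable_one.indicator hs), subsetSum]
  exact Finset.sum_eq_zero fun ζ hζ => by simp [hη ζ hζ]

end FinConf

open FinConf

/-! ### The thinning semigroup -/

section Weights

variable {m σ C : ℝ}

/-- The probability `e^{-tm}` that a point survives up to time `t`. -/
noncomputable def survival (m t : ℝ) : ℝ := Real.exp (-(t * m))

/-- The weight `(σ / (m C)) (1 - e^{-tm})` of a deleted point. -/
noncomputable def deletion (m σ C t : ℝ) : ℝ := σ / (m * C) * (1 - survival m t)

/-- The weight with which `k` points are kept and `j` points are deleted up to time `t`. -/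
noncomputable def thinWeight (m σ C t : ℝ) (k j : ℕ) : ℝ := survival m t ^ k * deletion m σ C t ^ j

theorem survival_nonneg (m t : ℝ) : 0 ≤ survival m t := (Real.exp_pos _).le

theorem survival_le_one (hm : 0 < m) {t : ℝ} (ht : 0 ≤ t) : survival m t ≤ 1 :=
  Real.exp_le_one_iff.2 (by have := mul_nonneg ht hm.le; linarith)

theorem deletion_nonneg (hm : 0 < m) (hσ : 0 ≤ σ) (hC0 : 0 < C) {t : ℝ} (ht : 0 ≤ t) :
    0 ≤ deletion m σ C t :=
  mul_nonneg (by positivity) (sub_nonneg.2 (survival_le_one hm ht))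

theorem survival_add_deletion_le (hm : 0 < m) (hC0 : 0 < C) (hC : σ / m ≤ C)
    {t : ℝ} (ht : 0 ≤ t) : survival m t + deletion m σ C t ≤ 1 := by
  have h1 : σ / (m * C) ≤ 1 := by
    rw [div_le_iff₀ hm] at hC
    rw [div_le_one (by positivity)]
    linarith
  have h2 := sub_nonneg.2 (survival_le_one hm ht)
  have := mul_le_mul_of_nonneg_right h1 h2
  rw [deletion]
  linarith

theorem thinWeight_nonneg (hm : 0 < m) (hσ : 0 ≤ σ) (hC0 : 0 < C) {t : ℝ} (ht : 0 ≤ t) (k j : ℕ) :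
    0 ≤ thinWeight m σ C t k j :=
  mul_nonneg (pow_nonneg (survival_nonneg _ _) _) (pow_nonneg (deletion_nonneg hm hσ hC0 ht) _)

theorem continuous_thinWeight (m σ C : ℝ) (k j : ℕ) :
    Continuous fun t => thinWeight m σ C t k j := by
  unfold thinWeight deletion survival
  fun_prop

theorem thinWeight_zero (m σ C : ℝ) (k j : ℕ) :
    thinWeight m σ C 0 k j = if j = 0 then 1 else 0 := by
  rcases eq_or_ne j 0 with h | h <;> simp [thinWeight, deletion, survival, h]

theorem subsetSum_thinWeight_add {d : ℕ} (s t : ℝ) (h : FinConf d → ℝ) :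
    subsetSum (thinWeight m σ C (s + t)) h =
      subsetSum (thinWeight m σ C t) (subsetSum (thinWeight m σ C s) h) := by
  funext η
  have e : survival m (s + t) = survival m t * survival m s := by
    rw [survival, survival, survival, ← Real.exp_add]
    ring_nf
  have := subsetSum_subsetSum (survival m t) (deletion m σ C t)
    (survival m s) (deletion m σ C s) h η
  have e' : deletion m σ C (s + t) =
      survival m t * deletion m σ C s + deletion m σ C t := by
    rw [deletion, deletion, deletion, e]
    ring
  unfold thinWeight
  rw [this, e, e']

theorem subsetSum_thinWeight_one_le {d : ℕ} (hm : 0 < m) (hσ : 0 ≤ σ) (hC0 : 0 < C)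
    (hC : σ / m ≤ C) {t : ℝ} (ht : 0 ≤ t) (η : FinConf d) :
    subsetSum (thinWeight m σ C t) (fun _ => 1) η ≤ 1 := by
  have := subsetSum_const_pow (survival m t) (deletion m σ C t) 1 η
  simp only [one_pow, mul_one] at this
  refine (le_of_eq this).trans (pow_le_one₀ ?_ (survival_add_deletion_le hm hC0 hC ht))
  exact add_nonneg (survival_nonneg _ _) (deletion_nonneg hm hσ hC0 ht)

theorem abs_subsetSum_thinWeight_le {d : ℕ} (hm : 0 < m) (hσ : 0 ≤ σ) (hC0 : 0 < C)
    (hC : σ / m ≤ C) {t : ℝ} (ht : 0 ≤ t) {h : FinConf d → ℝ} (hb : ∀ η, |h η| ≤ 1)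
    (η : FinConf d) : |subsetSum (thinWeight m σ C t) h η| ≤ 1 := by
  refine (abs_subsetSum_le _ hb η).trans ?_
  simp only [abs_of_nonneg (thinWeight_nonneg hm hσ hC0 ht _ _)]
  exact subsetSum_thinWeight_one_le hm hσ hC0 hC ht η

theorem subsetSum_thinWeight_zero {d : ℕ} (m σ C : ℝ) (h : FinConf d → ℝ) :
    subsetSum (thinWeight m σ C 0) h = h := by
  have : thinWeight m σ C 0 = fun k j => if j = 0 then (fun _ => 1) k else 0 := by
    funext k j
    exact thinWeight_zero m σ C k j
  funext η
  rw [this, subsetSum_zero, one_mul]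

end Weights

/-- `T t` is the predual of the thinning operator `h ↦ ∑_{ζ ⊆ η} w_t(|ζ|, |η \ ζ|) h(ζ)` with
respect to the measure `C^{|η|} dλ`. -/
structure IsThinning (d : ℕ) (m σ C : ℝ) (T : ℝ≥0 → LC d C →L[ℝ] LC d C) : Prop where
  contraction : ∀ t, ‖T t‖ ≤ 1
  dual : ∀ (t : ℝ≥0) (G : LC d C) (h : FinConf d → ℝ), Measurable h → (∀ η, |h η| ≤ 1) →
    ∫ η, T t G η * h η ∂(weighted d C) =
      ∫ η, G η * subsetSum (thinWeight m σ C t) h η ∂(weighted d C)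
  lintegral_le : ∀ (t : ℝ≥0) (G : LC d C) (f : FinConf d → ℝ≥0∞), Measurable f →
    ∫⁻ η, f η * ‖T t G η‖ₑ ∂(weighted d C) ≤
      ∫⁻ η, subsetSum (fun k j => ENNReal.ofReal (survival m t) ^ k *
        ENNReal.ofReal (deletion m σ C t) ^ j) f η * ‖G η‖ₑ ∂(weighted d C)

section Semigroup

variable {d : ℕ} {m σ C : ℝ}

theorem exists_isThinning (hd : 0 < d) (hm : 0 < m) (hσ : 0 ≤ σ) (hC0 : 0 < C) (hC : σ / m ≤ C) :
    ∃ T, IsThinning d m σ C T := by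
  have h1 : ∀ t : ℝ≥0, ENNReal.ofReal (survival m t) + ENNReal.ofReal (deletion m σ C t) ≤ 1 := by
    intro t
    rw [← ENNReal.ofReal_add (survival_nonneg _ _) (deletion_nonneg hm hσ hC0 t.coe_nonneg),
      ENNReal.ofReal_le_one]
    exact survival_add_deletion_le hm hC0 hC t.coe_nonneg
  choose T hT1 hT2 hT3 using fun t : ℝ≥0 => exists_predual (μ := weighted d C)
    (thinKernel d (ENNReal.ofReal (survival m t)) (ENNReal.ofReal (deletion m σ C t)))
    (thinKernel_univ_le (h1 t)) fun s hs h0 => thinKernel_null hd hC0 _ _ hs h0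
  refine ⟨T, hT1, fun t G h hh hb => ?_, fun t G f hf => ?_⟩
  · rw [hT2 t G h hh hb]
    simp only [integral_thinKernel (survival_nonneg _ _)
      (deletion_nonneg hm hσ hC0 t.coe_nonneg) hh hb]
    rfl
  · refine (hT3 t G f hf).trans (le_of_eq ?_)
    simp only [lintegral_thinKernel _ _ hf]

theorem integrable_coe_mul (G : LC d C) {h : FinConf d → ℝ} (hh : Measurable h) {c : ℝ}
    (hb : ∀ η, |h η| ≤ c) : Integrable (fun η => G η * h η) (weighted d C) :=
  (integrable_coe_Lp G).mul_bdd hh.aestronglyMeasurable (c := c) (Eventually.of_forall hb)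

theorem norm_le_integral_subsetSum {F G : LC d C} {W : ℕ → ℕ → ℝ}
    (hi : Integrable (fun η => |G η| * subsetSum (fun k j => |W k j|) (fun _ => 1) η)
      (weighted d C))
    (h : ∀ h : FinConf d → ℝ, Measurable h → (∀ η, |h η| ≤ 1) →
      ∫ η, F η * h η ∂(weighted d C) = ∫ η, G η * subsetSum W h η ∂(weighted d C)) :
    ‖F‖ ≤ ∫ η, |G η| * subsetSum (fun k j => |W k j|) (fun _ => 1) η ∂(weighted d C) := by
  refine norm_Lp_one_le_of_forall_integral_mul_le fun k hk hk1 => ?_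
  have hle : ∀ η, |G η * subsetSum W k η| ≤
      |G η| * subsetSum (fun k j => |W k j|) (fun _ => 1) η := fun η => by
    rw [abs_mul]
    exact mul_le_mul_of_nonneg_left (abs_subsetSum_le W hk1 η) (abs_nonneg _)
  rw [h k hk hk1]
  refine integral_mono (hi.mono' ?_ (Eventually.of_forall hle)) hi fun η =>
    (le_abs_self _).trans (hle η)
  exact ((measurable_coe_Lp G).mul (measurable_subsetSum W hk)).aestronglyMeasurable

theorem integral_sub_mul (F G : LC d C) {h : FinConf d → ℝ} (hh : Measurable h)
    (hb : ∀ η, |h η| ≤ 1) :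
    ∫ η, (F - G) η * h η ∂(weighted d C) =
      ∫ η, F η * h η ∂(weighted d C) - ∫ η, G η * h η ∂(weighted d C) := by
  rw [← integral_sub (integrable_coe_mul F hh hb) (integrable_coe_mul G hh hb)]
  refine integral_congr_ae ?_
  filter_upwards [Lp.coeFn_sub F G] with η hη
  rw [hη, Pi.sub_apply, sub_mul]

theorem integral_smul_mul (c : ℝ) (F : LC d C) (h : FinConf d → ℝ) :
    ∫ η, (c • F) η * h η ∂(weighted d C) = c * ∫ η, F η * h η ∂(weighted d C) := by
  rw [← integral_const_mul]
  refine integral_congr_ae ?_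
  filter_upwards [Lp.coeFn_smul c F] with η hη
  rw [hη, Pi.smul_apply, smul_eq_mul, mul_assoc]

theorem integrable_abs_mul_subsetSum (G : LC d C) {W : ℕ → ℕ → ℝ} {B : FinConf d → ℝ}
    (hB : Integrable (fun η => |G η| * B η) (weighted d C))
    (hWB : ∀ η : FinConf d, subsetSum (fun k j => |W k j|) (fun _ => 1) η ≤ B η) :
    Integrable (fun η => |G η| * subsetSum (fun k j => |W k j|) (fun _ => 1) η)
      (weighted d C) := by
  refine hB.mono' ((measurable_coe_Lp G).abs.mul
    (measurable_subsetSum _ measurable_const)).aestronglyMeasurable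
    (Eventually.of_forall fun η => ?_)
  rw [Real.norm_of_nonneg]
  · exact mul_le_mul_of_nonneg_left (hWB η) (abs_nonneg _)
  · exact mul_nonneg (abs_nonneg _)
      (Finset.sum_nonneg fun ζ _ => mul_nonneg (abs_nonneg _) zero_le_one)

/-- Dominated convergence for sums over subconfigurations: a finite sum of weights tending to zero
tends to zero at each `η`. -/
theorem tendsto_integral_subsetSum {ι : Type*} {l : Filter ι} [l.IsCountablyGenerated]
    (G : LC d C) {W : ι → ℕ → ℕ → ℝ} (hW : ∀ k j, Tendsto (fun i => W i k j) l (𝓝 0))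
    {B : FinConf d → ℝ} (hB : Integrable (fun η => |G η| * B η) (weighted d C))
    (hWB : ∀ᶠ i in l, ∀ η : FinConf d, subsetSum (fun k j => |W i k j|) (fun _ => 1) η ≤ B η) :
    Tendsto (fun i => ∫ η, |G η| * subsetSum (fun k j => |W i k j|) (fun _ => 1) η
      ∂(weighted d C)) l (𝓝 0) := by
  have h0 : (0 : ℝ) = ∫ _η, (0 : ℝ) ∂(weighted d C) := by simp
  rw [h0]
  refine tendsto_integral_filter_of_dominated_convergence _
    (Eventually.of_forall fun i => ?_) ?_ hB (Eventually.of_forall fun η => ?_)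
  · exact ((measurable_coe_Lp G).abs.mul
      (measurable_subsetSum _ measurable_const)).aestronglyMeasurable
  · filter_upwards [hWB] with i hi
    refine Eventually.of_forall fun η => ?_
    rw [Real.norm_of_nonneg]
    · exact mul_le_mul_of_nonneg_left (hi η) (abs_nonneg _)
    · exact mul_nonneg (abs_nonneg _)
        (Finset.sum_nonneg fun ζ _ => mul_nonneg (abs_nonneg _) zero_le_one)
  · have h1 : Tendsto (fun i => subsetSum (fun k j => |W i k j|) (fun _ => 1) η) l (𝓝 0) := by
      unfold subsetSum
      rw [← Finset.sum_const_zero (s := η.pts.powerset)]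
      refine tendsto_finsetSum _ fun ζ _ => ?_
      simpa using (hW ζ.card (η.pts \ ζ).card).abs
    simpa using h1.const_mul |G η|

variable {T : ℝ≥0 → LC d C →L[ℝ] LC d C}

theorem IsThinning.isC0ContractionSemigroup (hT : IsThinning d m σ C T) (hm : 0 < m) (hσ : 0 ≤ σ)
    (hC0 : 0 < C) (hC : σ / m ≤ C) : IsC0ContractionSemigroup T where
  map_zero := by
    refine ContinuousLinearMap.ext fun G => Lp_one_ext fun h hh hb => ?_
    rw [hT.dual 0 G h hh hb]
    rw [NNReal.coe_zero, subsetSum_thinWeight_zero]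
    rfl
  map_add s t := by
    refine ContinuousLinearMap.ext fun G => Lp_one_ext fun h hh hb => ?_
    rw [hT.dual _ G h hh hb, ContinuousLinearMap.comp_apply, hT.dual s _ h hh hb,
      hT.dual t G _ (measurable_subsetSum _ hh)
        (abs_subsetSum_thinWeight_le hm hσ hC0 hC s.coe_nonneg hb), NNReal.coe_add,
      subsetSum_thinWeight_add]
  contraction := hT.contraction
  strong_cont G := by
    refine continuous_iff_continuousAt.2 fun s => ?_
    rw [ContinuousAt, tendsto_iff_norm_sub_tendsto_zero]
    have hbd : ∀ t : ℝ≥0, ∀ η : FinConf d, subsetSum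
        (fun k j => |thinWeight m σ C t k j - thinWeight m σ C s k j|) (fun _ => 1) η ≤ 2 := by
      intro t η
      refine (subsetSum_le_subsetSum (W' := fun k j => thinWeight m σ C t k j +
        thinWeight m σ C s k j) (fun k j => ?_) η).trans ?_
      · refine (abs_sub _ _).trans (le_of_eq ?_)
        rw [abs_of_nonneg (thinWeight_nonneg hm hσ hC0 t.coe_nonneg k j),
          abs_of_nonneg (thinWeight_nonneg hm hσ hC0 s.coe_nonneg k j)]
      · rw [subsetSum_add]
        have h1 := subsetSum_thinWeight_one_le hm hσ hC0 hC t.coe_nonneg η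
        have h2 := subsetSum_thinWeight_one_le hm hσ hC0 hC s.coe_nonneg η
        exact (add_le_add h1 h2).trans (by norm_num)
    have hBi : Integrable (fun η => |G η| * (fun _ : FinConf d => (2 : ℝ)) η) (weighted d C) :=
      (integrable_coe_Lp G).abs.mul_const 2
    refine squeeze_zero (fun _ => norm_nonneg _) (fun t => norm_le_integral_subsetSum (G := G)
      (W := fun k j => thinWeight m σ C t k j - thinWeight m σ C s k j) ?_ ?_)
      (tendsto_integral_subsetSum G (fun k j => ?_) hBi (Eventually.of_forall hbd))
    · exact integrable_abs_mul_subsetSum G hBi (hbd t)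
    · intro h hh hb
      have hb' := fun t : ℝ≥0 =>
        abs_subsetSum_thinWeight_le (d := d) hm hσ hC0 hC t.coe_nonneg hb
      rw [integral_sub_mul _ _ hh hb, hT.dual t G h hh hb, hT.dual s G h hh hb,
        ← integral_sub (integrable_coe_mul G (measurable_subsetSum _ hh) (hb' t))
          (integrable_coe_mul G (measurable_subsetSum _ hh) (hb' s))]
      refine integral_congr_ae (Eventually.of_forall fun η => ?_)
      dsimp only
      rw [subsetSum_sub, mul_sub]
    · have h1 : Continuous fun t : ℝ≥0 => thinWeight m σ C t k j - thinWeight m σ C s k j :=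
        ((continuous_thinWeight m σ C k j).comp NNReal.continuous_coe).sub continuous_const
      simpa using h1.tendsto s

end Semigroup

/-! ### The Mecke formula for the weighted measure -/

namespace FinConf

variable {d : ℕ} {C : ℝ}

theorem lintegral_weighted (d : ℕ) (C : ℝ) {f : FinConf d → ℝ≥0∞} (hf : Measurable f) :
    ∫⁻ η, f η ∂(weighted d C) = ∫⁻ η, ENNReal.ofReal C ^ η.card * f η ∂(lebesguePoisson d) := by
  rw [weighted, lintegral_withDensity_eq_lintegral_mul _ (measurable_const.pow measurable_card) hf]
  rfl

theorem lintegral_weighted_two_mul (d : ℕ) (C : ℝ) {f : FinConf d → ℝ≥0∞} (hf : Measurable f) :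
    ∫⁻ η, f η ∂(weighted d (2 * C)) = ∫⁻ η, 2 ^ η.card * f η ∂(weighted d C) := by
  rw [lintegral_weighted d _ hf,
    lintegral_weighted d _ (f := fun η => 2 ^ η.card * f η)
      ((measurable_const.pow measurable_card).mul hf)]
  refine lintegral_congr fun η => ?_
  rw [ENNReal.ofReal_mul zero_le_two, mul_pow, ENNReal.ofReal_ofNat]
  ring

theorem integrable_weighted_two_mul_iff {g : FinConf d → ℝ} (hg : Measurable g) :
    Integrable g (weighted d (2 * C)) ↔
      Integrable (fun η => 2 ^ η.card * g η) (weighted d C) := by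
  have hm : Measurable fun η : FinConf d => (2 : ℝ) ^ η.card * g η :=
    (measurable_const.pow measurable_card).mul hg
  have e : ∀ η : FinConf d, ‖(2 : ℝ) ^ η.card * g η‖ₑ = 2 ^ η.card * ‖g η‖ₑ := fun η => by
    rw [enorm_mul, enorm_pow, Real.enorm_of_nonneg zero_le_two, ENNReal.ofReal_ofNat]
  simp only [Integrable, hg.aestronglyMeasurable, hm.aestronglyMeasurable, true_and,
    HasFiniteIntegral, e, lintegral_weighted_two_mul d C hg.enorm]

theorem card_erase {η : FinConf d} {x : EuclideanSpace ℝ (Fin d)} (hx : x ∈ η.pts) :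
    (η.erase x).card = η.card - 1 :=
  Finset.card_erase_of_mem hx

theorem lintegral_add_mul_weighted (hd : 0 < d) (hC : 0 < C) {g h : FinConf d → ℝ≥0∞}
    (hg : Measurable g) (hh : Measurable h) :
    ∫⁻ η, (∫⁻ x, g (η.add x)) * h η ∂(weighted d C) =
      ∫⁻ η, g η * (ENNReal.ofReal C⁻¹ * ∑ x ∈ η.pts, h (η.erase x)) ∂(weighted d C) := by
  have hw : Measurable fun η : FinConf d => ENNReal.ofReal C ^ η.card :=
    measurable_const.pow measurable_card
  rw [lintegral_weighted d C (f := fun η => (∫⁻ x, g (η.add x)) * h η)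
      ((measurable_lintegral_add hg).mul hh),
    lintegral_weighted d C
      (f := fun η => g η * (ENNReal.ofReal C⁻¹ * ∑ x ∈ η.pts, h (η.erase x)))
      (hg.mul ((measurable_sum_erase hh).const_mul _))]
  have key := lintegral_add_mul hd hg (h := fun η => ENNReal.ofReal C ^ η.card * h η) (hw.mul hh)
  calc _ = _ := lintegral_congr fun η => by ring
    _ = _ := key
    _ = _ := by
      refine lintegral_congr fun η => ?_
      rw [mul_left_comm]
      congr 1
      rw [Finset.mul_sum, Finset.mul_sum]
      refine Finset.sum_congr rfl fun x hx => ?_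
      have hpos : 0 < η.card := Finset.card_pos.2 ⟨x, hx⟩
      obtain ⟨n, hn⟩ := Nat.exists_eq_succ_of_ne_zero hpos.ne'
      rw [card_erase hx, hn, Nat.succ_sub_one, pow_succ, ← mul_assoc, mul_assoc (_ ^ n),
        ← ENNReal.ofReal_mul hC.le, mul_inv_cancel₀ hC.ne', ENNReal.ofReal_one, mul_one]

variable {g : FinConf d → ℝ}

theorem integrable_card_mul (hg : Measurable g) (hgi : Integrable g (weighted d (2 * C))) :
    Integrable (fun η => (η.card : ℝ) * g η) (weighted d C) := by
  refine ((integrable_weighted_two_mul_iff hg).1 hgi).mono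
    ((measurable_from_top.comp measurable_card).mul hg).aestronglyMeasurable
    (Eventually.of_forall fun η => ?_)
  rw [norm_mul, norm_mul]
  refine mul_le_mul_of_nonneg_right ?_ (norm_nonneg _)
  rw [Real.norm_of_nonneg (by positivity), Real.norm_of_nonneg (by positivity)]
  exact_mod_cast Nat.lt_two_pow_self.le

theorem lintegral_add_lt_top (hd : 0 < d) (hC : 0 < C) (hg : Measurable g)
    (hgi : Integrable g (weighted d (2 * C))) :
    ∫⁻ η : FinConf d, (∫⁻ x, ‖g (η.add x)‖ₑ) ∂(weighted d C) < ∞ := by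
  have h1 := lintegral_add_mul_weighted hd hC hg.enorm (measurable_const (a := (1 : ℝ≥0∞)))
  simp only [mul_one] at h1
  rw [h1]
  have h2 := ((integrable_card_mul hg hgi).const_mul C⁻¹).2
  refine lt_of_le_of_lt (lintegral_mono fun η => le_of_eq ?_) h2
  have hn : ‖(η.card : ℝ)‖ₑ = (η.pts.card : ℝ≥0∞) := by
    rw [Real.enorm_of_nonneg (Nat.cast_nonneg _), ENNReal.ofReal_natCast, card]
  simp only [Finset.sum_const, nsmul_eq_mul, mul_one, enorm_mul]
  rw [Real.enorm_of_nonneg (inv_nonneg.2 hC.le), hn]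
  ring

theorem ae_integrable_add (hd : 0 < d) (hC : 0 < C) (hg : Measurable g)
    (hgi : Integrable g (weighted d (2 * C))) :
    ∀ᵐ η ∂(weighted d C), Integrable fun x => g (η.add x) := by
  filter_upwards [ae_lt_top (measurable_lintegral_add hg.enorm)
    (lintegral_add_lt_top hd hC hg hgi).ne] with η hη
  exact ⟨(hg.comp (measurable_add η)).aestronglyMeasurable, hη⟩

theorem integrable_integral_add (hd : 0 < d) (hC : 0 < C) (hg : Measurable g)
    (hgi : Integrable g (weighted d (2 * C))) :
    Integrable (fun η => ∫ x, g (η.add x)) (weighted d C) := by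
  refine ⟨(measurable_integral_add hg).aestronglyMeasurable, lt_of_le_of_lt
    (lintegral_mono fun η => enorm_integral_le_lintegral_enorm _)
    (lintegral_add_lt_top hd hC hg hgi)⟩

theorem abs_sum_erase_le {h : FinConf d → ℝ} {c : ℝ} (hb : ∀ η, |h η| ≤ c) (η : FinConf d) :
    |∑ x ∈ η.pts, h (η.erase x)| ≤ η.card * c := by
  refine (Finset.abs_sum_le_sum_abs _ _).trans ?_
  have := Finset.sum_le_card_nsmul η.pts (fun x => |h (η.erase x)|) c fun x _ => hb _
  rwa [nsmul_eq_mul] at this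

theorem integrable_mul_sum_erase (hg : Measurable g) (hgi : Integrable g (weighted d (2 * C)))
    {h : FinConf d → ℝ} (hh : Measurable h) {c : ℝ} (hb : ∀ η, |h η| ≤ c) :
    Integrable (fun η => g η * (C⁻¹ * ∑ x ∈ η.pts, h (η.erase x))) (weighted d C) := by
  refine ((integrable_card_mul hg hgi).norm.const_mul (|C⁻¹| * c)).mono'
    (hg.mul ((measurable_sum_erase hh).const_mul _)).aestronglyMeasurable
    (Eventually.of_forall fun η => ?_)
  rw [norm_mul, norm_mul, norm_mul, Real.norm_natCast, Real.norm_eq_abs C⁻¹]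
  have := mul_le_mul_of_nonneg_left (abs_sum_erase_le hb η)
    (mul_nonneg (norm_nonneg (g η)) (abs_nonneg C⁻¹))
  calc _ = ‖g η‖ * |C⁻¹| * |∑ x ∈ η.pts, h (η.erase x)| := by rw [mul_assoc]; rfl
    _ ≤ _ := this
    _ = _ := by ring

theorem integral_add_mul_of_nonneg (hd : 0 < d) (hC : 0 < C) (hg : Measurable g)
    (hgi : Integrable g (weighted d (2 * C))) (hg0 : ∀ η, 0 ≤ g η) {h : FinConf d → ℝ}
    (hh : Measurable h) (hh0 : ∀ η, 0 ≤ h η) :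
    ∫ η, (∫ x, g (η.add x)) * h η ∂(weighted d C) =
      ∫ η, g η * (C⁻¹ * ∑ x ∈ η.pts, h (η.erase x)) ∂(weighted d C) := by
  rw [integral_eq_lintegral_of_nonneg_ae
      (Eventually.of_forall fun η => mul_nonneg (integral_nonneg fun x => hg0 _) (hh0 η))
      ((measurable_integral_add hg).mul hh).aestronglyMeasurable,
    integral_eq_lintegral_of_nonneg_ae
      (Eventually.of_forall fun η => mul_nonneg (hg0 η)
        (mul_nonneg (inv_nonneg.2 hC.le) (Finset.sum_nonneg fun x _ => hh0 _)))
      (hg.mul ((measurable_sum_erase hh).const_mul _)).aestronglyMeasurable]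
  congr 1
  have key := lintegral_add_mul_weighted hd hC hg.ennreal_ofReal hh.ennreal_ofReal
  calc _ = ∫⁻ η, (∫⁻ x, ENNReal.ofReal (g (η.add x))) * ENNReal.ofReal (h η) ∂(weighted d C) := by
        refine lintegral_congr_ae ?_
        filter_upwards [ae_integrable_add hd hC hg hgi] with η hη
        rw [ENNReal.ofReal_mul' (hh0 η),
          ofReal_integral_eq_lintegral_ofReal hη (Eventually.of_forall fun x => hg0 _)]
    _ = _ := key
    _ = _ := by
        refine lintegral_congr fun η => ?_
        rw [ENNReal.ofReal_mul (hg0 η), ENNReal.ofReal_mul (inv_nonneg.2 hC.le),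
          ENNReal.ofReal_sum_of_nonneg fun x _ => hh0 _]

/-- The Mecke formula for the measure `C^{|η|} dλ` and a bounded test function. -/
theorem integral_add_mul (hd : 0 < d) (hC : 0 < C) (hg : Measurable g)
    (hgi : Integrable g (weighted d (2 * C))) {h : FinConf d → ℝ}
    (hh : Measurable h) (hb : ∀ η, |h η| ≤ 1) :
    ∫ η, (∫ x, g (η.add x)) * h η ∂(weighted d C) =
      ∫ η, g η * (C⁻¹ * ∑ x ∈ η.pts, h (η.erase x)) ∂(weighted d C) := by
  have hmul : ∀ {g : FinConf d → ℝ}, Measurable g → Integrable g (weighted d (2 * C)) →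
      ∀ {k : FinConf d → ℝ}, Measurable k → ∀ {c : ℝ}, (∀ η, |k η| ≤ c) →
      Integrable (fun η => (∫ x, g (η.add x)) * k η) (weighted d C) :=
    fun hg hgi k hk c hc => (integrable_integral_add hd hC hg hgi).mul_bdd
      hk.aestronglyMeasurable (Eventually.of_forall hc)
  -- A bounded `h` is the difference of the nonnegative functions `h + 1` and `1`.
  have step : ∀ {g : FinConf d → ℝ}, Measurable g → Integrable g (weighted d (2 * C)) →
      (∀ η, 0 ≤ g η) → ∫ η, (∫ x, g (η.add x)) * h η ∂(weighted d C) =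
      ∫ η, g η * (C⁻¹ * ∑ x ∈ η.pts, h (η.erase x)) ∂(weighted d C) := by
    intro g hg hgi hg0
    have hb2 : ∀ η, |h η + 1| ≤ 2 := fun η => by
      have := abs_le.1 (hb η)
      rw [abs_le]
      constructor <;> linarith
    have hb1 : ∀ _ : FinConf d, |(1 : ℝ)| ≤ 1 := fun _ => by simp
    have e1 := integral_add_mul_of_nonneg hd hC hg hgi hg0 (hh.add_const 1) fun η => by
      have := (abs_le.1 (hb η)).1
      linarith
    have e2 := integral_add_mul_of_nonneg hd hC hg hgi hg0
      (measurable_const (a := (1 : ℝ))) fun _ => zero_le_one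
    have h1 := integral_sub (hmul hg hgi (hh.add_const 1) hb2) (hmul hg hgi measurable_const hb1)
    have h2 := integral_sub (integrable_mul_sum_erase hg hgi (hh.add_const 1) hb2)
      (integrable_mul_sum_erase hg hgi (measurable_const (a := (1 : ℝ))) hb1)
    rw [e1, e2, ← h2] at h1
    calc _ = _ := integral_congr_ae (Eventually.of_forall fun η => by ring)
      _ = _ := h1
      _ = _ := by
        refine integral_congr_ae (Eventually.of_forall fun η => ?_)
        dsimp only
        rw [Finset.sum_add_distrib]
        ring
  have hgp : Measurable fun η => max (g η) 0 := hg.max measurable_const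
  have hgn : Measurable fun η => max (-g η) 0 := hg.neg.max measurable_const
  have h1 := integral_sub (hmul hgp hgi.pos_part hh hb) (hmul hgn hgi.neg_part hh hb)
  have h2 := integral_sub (integrable_mul_sum_erase hgp hgi.pos_part hh hb)
    (integrable_mul_sum_erase hgn hgi.neg_part hh hb)
  rw [step hgp hgi.pos_part fun _ => le_max_right _ _,
    step hgn hgi.neg_part fun _ => le_max_right _ _, ← h2] at h1
  have hpn : ∀ a : ℝ, max a 0 - max (-a) 0 = a := fun a => by
    rcases le_total 0 a with h | h <;> simp [h]
  calc _ = _ := by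
        refine integral_congr_ae ?_
        filter_upwards [ae_integrable_add hd hC hgp hgi.pos_part,
          ae_integrable_add hd hC hgn hgi.neg_part] with η hη hη'
        rw [← sub_mul, ← integral_sub hη hη']
        simp only [hpn]
    _ = _ := h1
    _ = _ := by
        refine integral_congr_ae (Eventually.of_forall fun η => ?_)
        dsimp only
        rw [← sub_mul, hpn]

end FinConf

/-! ### The operator `L̂` and its duality with thinning -/

section Generator

variable {d : ℕ} {m σ C : ℝ}

/-- The derivative at `t = 0` of the thinning weights: `-m k` for deleting no point, `σ / C` for
deleting one point, and `0` otherwise. -/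
noncomputable def genWeight (m σ C : ℝ) (k j : ℕ) : ℝ :=
  (if j = 0 then -(m * k) else 0) + if j = 1 then σ / C else 0

theorem subsetSum_genWeight (h : FinConf d → ℝ) (η : FinConf d) :
    subsetSum (genWeight m σ C) h η =
      -(m * η.card) * h η + σ / C * ∑ x ∈ η.pts, h (η.erase x) := by
  have := subsetSum_add (fun k j => if j = 0 then (fun k : ℕ => -(m * k)) k else 0)
    (fun _ j => if j = 1 then σ / C else 0) h η
  rw [subsetSum_zero, subsetSum_single] at this
  exact this

theorem integrable_lHat (m σ : ℝ) (hd : 0 < d) (hC0 : 0 < C) {g : FinConf d → ℝ}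
    (hg : Measurable g) (hgi : Integrable g (weighted d (2 * C))) :
    Integrable (lHat m σ g) (weighted d C) := by
  refine (((integrable_card_mul hg hgi).const_mul (-m)).add
    ((integrable_integral_add hd hC0 hg hgi).const_mul σ)).congr
    (Eventually.of_forall fun η => ?_)
  simp only [Pi.add_apply, lHat]
  ring

theorem integral_lHat_mul (hd : 0 < d) (hC0 : 0 < C) {g : FinConf d → ℝ} (hg : Measurable g)
    (hgi : Integrable g (weighted d (2 * C))) {h : FinConf d → ℝ} (hh : Measurable h)
    (hb : ∀ η, |h η| ≤ 1) :
    ∫ η, lHat m σ g η * h η ∂(weighted d C) =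
      ∫ η, g η * subsetSum (genWeight m σ C) h η ∂(weighted d C) := by
  have h1 : Integrable (fun η : FinConf d => (η.card : ℝ) * g η * h η) (weighted d C) :=
    (integrable_card_mul hg hgi).mul_bdd hh.aestronglyMeasurable (Eventually.of_forall hb)
  have h2 : Integrable (fun η => (∫ x, g (η.add x)) * h η) (weighted d C) :=
    (integrable_integral_add hd hC0 hg hgi).mul_bdd hh.aestronglyMeasurable
      (Eventually.of_forall hb)
  have h3 := integrable_mul_sum_erase (C := C) hg hgi hh hb
  calc _ = ∫ η, (-m * ((η.card : ℝ) * g η * h η) + σ * ((∫ x, g (η.add x)) * h η))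
        ∂(weighted d C) := by
        refine integral_congr_ae (Eventually.of_forall fun η => ?_)
        simp only [lHat]
        ring
    _ = ∫ η, (-m * ((η.card : ℝ) * g η * h η) +
          σ * (g η * (C⁻¹ * ∑ x ∈ η.pts, h (η.erase x)))) ∂(weighted d C) := by
        rw [integral_add (h1.const_mul _) (h2.const_mul _),
          integral_add (h1.const_mul _) (h3.const_mul _), integral_const_mul σ,
          integral_const_mul σ, integral_add_mul hd hC0 hg hgi hh hb]
    _ = _ := by
        refine integral_congr_ae (Eventually.of_forall fun η => ?_)
        simp only [subsetSum_genWeight]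
        ring

theorem integrable_two_mul_congr (hC0 : 0 < C) {f g : FinConf d → ℝ}
    (h : f =ᵐ[weighted d C] g) :
    Integrable f (weighted d (2 * C)) ↔ Integrable g (weighted d (2 * C)) :=
  integrable_congr ((ae_weighted_iff (mul_pos two_pos hC0)).2 ((ae_weighted_iff hC0).1 h))

theorem existsUnique_mem_lHatGraph (hd : 0 < d) (hC0 : 0 < C) {G : LC d C}
    (hG : Integrable G (weighted d (2 * C))) : ∃! H : LC d C, (G, H) ∈ lHatGraph d m σ C := by
  have hGm := measurable_coe_Lp G
  have hL := integrable_lHat m σ hd hC0 hGm hG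
  refine ⟨hL.toL1, ⟨G, hGm, EventuallyEq.rfl, hG, ae_integrable_add hd hC0 hGm hG,
    hL.coeFn_toL1⟩, ?_⟩
  rintro H ⟨g, hg, hGg, hgi, -, hH⟩
  refine Lp.ext (hH.trans (EventuallyEq.trans ?_ hL.coeFn_toL1.symm))
  filter_upwards [hGg, (ae_weighted_iff hC0).2 (ae_add hd ((ae_weighted_iff hC0).1 hGg))]
    with η h1 h2
  rw [lHat, lHat, ← h1, integral_congr_ae h2]

theorem integrable_of_mem_lHatGraph (hC0 : 0 < C) {G H : LC d C}
    (h : (G, H) ∈ lHatGraph d m σ C) : Integrable G (weighted d (2 * C)) := by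
  obtain ⟨g, -, hGg, hgi, -⟩ := h
  exact (integrable_two_mul_congr hC0 hGg).2 hgi

theorem integral_mul_of_mem_lHatGraph (hd : 0 < d) (hC0 : 0 < C) {G H : LC d C}
    (hGH : (G, H) ∈ lHatGraph d m σ C) {h : FinConf d → ℝ} (hh : Measurable h)
    (hb : ∀ η, |h η| ≤ 1) :
    ∫ η, H η * h η ∂(weighted d C) =
      ∫ η, G η * subsetSum (genWeight m σ C) h η ∂(weighted d C) := by
  obtain ⟨g, hg, hGg, hgi, -, hH⟩ := hGH
  calc _ = ∫ η, lHat m σ g η * h η ∂(weighted d C) :=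
        integral_congr_ae (hH.mono fun η hη => by simp only [hη])
    _ = _ := integral_lHat_mul hd hC0 hg hgi hh hb
    _ = _ := integral_congr_ae (hGg.mono fun η hη => by simp only at hη; simp only [hη])

/-! ### Differentiation of the thinning weights -/

theorem hasDerivAt_thinWeight (hm : 0 < m) (k j : ℕ) :
    HasDerivAt (fun t => thinWeight m σ C t k j) (genWeight m σ C k j) 0 := by
  have hs : HasDerivAt (survival m) (-m) 0 := by
    have := ((hasDerivAt_mul_const m (x := (0 : ℝ))).neg).exp
    have e : survival m = fun t => Real.exp (-(t * m)) := rfl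
    rw [e]
    simpa using this
  have hq : HasDerivAt (deletion m σ C) (σ / C) 0 := by
    have := (hs.const_sub 1).const_mul (σ / (m * C))
    refine this.congr_deriv ?_
    field_simp
  have h := (hs.pow k).mul (hq.pow j)
  have hs0 : survival m 0 = 1 := by simp [survival]
  have hq0 : deletion m σ C 0 = 0 := by simp [deletion, hs0]
  refine h.congr_deriv ?_
  simp only [Pi.pow_apply, hs0, hq0, one_pow, genWeight]
  rcases j with _ | _ | j
  · simp [mul_comm]
  · simp
  · simp

theorem one_sub_survival_pow_le (m t : ℝ) (k : ℕ) :
    1 - survival m t ^ k ≤ t * (m * k) := by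
  rw [survival, ← Real.exp_nat_mul]
  have := Real.add_one_le_exp ((k : ℝ) * -(t * m))
  linarith

theorem deletion_le (hm : 0 < m) (hσ : 0 ≤ σ) (hC0 : 0 < C) {t : ℝ} :
    deletion m σ C t ≤ t * (σ / C) := by
  have h1 := one_sub_survival_pow_le m t 1
  rw [pow_one, Nat.cast_one, mul_one] at h1
  refine (mul_le_mul_of_nonneg_left h1 (by positivity)).trans (le_of_eq ?_)
  field_simp

/-- The difference quotients of the weights at `t = 0`, minus their limit, are bounded uniformly in
`t` and in the number of deleted points, except for the term linear in `k` when no point is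
deleted. -/
theorem abs_slope_thinWeight_sub_le (hm : 0 < m) (hσ : 0 ≤ σ) (hC0 : 0 < C) (hC : σ / m ≤ C)
    {t : ℝ} (ht : 0 < t) (k j : ℕ) :
    |t⁻¹ * (thinWeight m σ C t k j - thinWeight m σ C 0 k j) - genWeight m σ C k j| ≤
      (if j = 0 then 2 * m * k else 0) + 2 * (σ / C) := by
  have hs0 := survival_nonneg m t
  have hs1 := survival_le_one hm ht.le
  have hq0 := deletion_nonneg hm hσ hC0 ht.le
  have hq1 : deletion m σ C t ≤ 1 := by
    have := survival_add_deletion_le hm hC0 hC ht.le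
    linarith
  have hσC : 0 ≤ σ / C := by positivity
  have hsk0 : 0 ≤ survival m t ^ k := pow_nonneg hs0 k
  have hsk1 : survival m t ^ k ≤ 1 := pow_le_one₀ hs0 hs1
  -- With at least one deleted point the weight is at most the deletion weight.
  have hpos : ∀ j, 0 ≤ t⁻¹ * thinWeight m σ C t k (j + 1) ∧
      t⁻¹ * thinWeight m σ C t k (j + 1) ≤ σ / C := by
    intro j
    refine ⟨mul_nonneg (inv_nonneg.2 ht.le) (thinWeight_nonneg hm hσ hC0 ht.le _ _), ?_⟩
    rw [inv_mul_le_iff₀ ht]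
    refine le_trans ?_ (deletion_le hm hσ hC0)
    rw [thinWeight, pow_succ, ← mul_assoc]
    refine mul_le_of_le_one_left hq0 (mul_le_one₀ hsk1 (pow_nonneg hq0 j) (pow_le_one₀ hq0 hq1))
  rw [thinWeight_zero]
  rcases j with _ | _ | j
  · have h1 := one_sub_survival_pow_le m t k
    have h2 : t⁻¹ * (1 - survival m t ^ k) ≤ m * k := by rwa [inv_mul_le_iff₀ ht]
    have h3 : 0 ≤ t⁻¹ * (1 - survival m t ^ k) :=
      mul_nonneg (inv_nonneg.2 ht.le) (sub_nonneg.2 hsk1)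
    have h4 : (0 : ℝ) ≤ m * k := by positivity
    simp only [thinWeight, genWeight, pow_zero, mul_one, if_true, zero_ne_one, if_false, add_zero]
    rw [abs_le]
    constructor <;> linarith
  · obtain ⟨h1, h2⟩ := hpos 0
    rw [zero_add] at h1 h2
    simp only [genWeight, zero_add, one_ne_zero, if_true, if_false, sub_zero]
    rw [abs_le]
    constructor <;> linarith
  · obtain ⟨h1, h2⟩ := hpos (j + 1)
    have hj : j + 1 + 1 ≠ 1 := by omega
    simp only [genWeight, zero_add, Nat.succ_ne_zero, hj, if_false, sub_zero]
    rw [abs_le]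
    constructor <;> linarith

/-! ### The closure of `L̂` generates the thinning semigroup -/

theorem IsThinning.lHatGraph_subset {T : ℝ≥0 → LC d C →L[ℝ] LC d C} (hT : IsThinning d m σ C T)
    (hd : 0 < d) (hm : 0 < m) (hσ : 0 ≤ σ) (hC0 : 0 < C) (hC : σ / m ≤ C) :
    (lHatGraph d m σ C : Set (LC d C × LC d C)) ⊆ generatorGraph T := by
  rintro ⟨G, H⟩ hGH
  change (G, H) ∈ lHatGraph d m σ C at hGH
  have hσC : 0 ≤ σ / C := by positivity
  have hG2 := integrable_of_mem_lHatGraph hC0 hGH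
  have hGm := measurable_coe_Lp G
  let W : ℝ≥0 → ℕ → ℕ → ℝ := fun t k j =>
    (t : ℝ)⁻¹ * (thinWeight m σ C t k j - thinWeight m σ C 0 k j) - genWeight m σ C k j
  let B : FinConf d → ℝ := fun η => (2 * m + 2 * (σ / C)) * 2 ^ η.card
  have hBi : Integrable (fun η => |G η| * B η) (weighted d C) := by
    refine (((integrable_weighted_two_mul_iff hGm).1 hG2).norm.const_mul
      (2 * m + 2 * (σ / C))).congr (Eventually.of_forall fun η => ?_)
    simp only [B, norm_mul, norm_pow, Real.norm_ofNat, Real.norm_eq_abs]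
    ring
  have hWB : ∀ t : ℝ≥0, 0 < t → ∀ η : FinConf d,
      subsetSum (fun k j => |W t k j|) (fun _ => 1) η ≤ B η := by
    intro t ht η
    refine (subsetSum_le_subsetSum (fun k j =>
      abs_slope_thinWeight_sub_le hm hσ hC0 hC (t := t) ht k j) η).trans ?_
    have h1 := subsetSum_add (fun k j => if j = 0 then (fun k : ℕ => 2 * m * (k : ℝ)) k else 0)
      (fun _ _ => 2 * (σ / C)) (fun _ => 1) η
    rw [subsetSum_zero] at h1
    refine (le_of_eq h1).trans ?_
    have h2 : subsetSum (fun _ _ => 2 * (σ / C)) (fun _ => 1) η = 2 ^ η.card * (2 * (σ / C)) := by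
      simp [subsetSum, card]
    have h3 : (η.card : ℝ) ≤ 2 ^ η.card := by exact_mod_cast Nat.lt_two_pow_self.le
    rw [h2]
    simp only [B, mul_one]
    nlinarith
  have hWi : ∀ t : ℝ≥0, 0 < t → Integrable
      (fun η => |G η| * subsetSum (fun k j => |W t k j|) (fun _ => 1) η) (weighted d C) :=
    fun t ht => integrable_abs_mul_subsetSum G hBi (hWB t ht)
  have hlim : ∀ k j, Tendsto (fun t => W t k j) (𝓝[>] 0) (𝓝 0) := by
    intro k j
    have h1 := (hasDerivAt_thinWeight (σ := σ) (C := C) hm k j).tendsto_slope_zero_right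
    have h2 : Tendsto (fun t : ℝ≥0 => (t : ℝ)) (𝓝[>] 0) (𝓝[>] 0) := by
      refine tendsto_nhdsWithin_iff.2 ⟨?_, ?_⟩
      · exact (NNReal.continuous_coe.tendsto 0).mono_left nhdsWithin_le_nhds
      · filter_upwards [self_mem_nhdsWithin] with r hr
        simpa using hr
    have h3 := (h1.comp h2).sub_const (genWeight m σ C k j)
    rw [sub_self] at h3
    refine h3.congr fun t => ?_
    simp [W]
  change Tendsto _ _ _
  rw [tendsto_iff_norm_sub_tendsto_zero]
  refine squeeze_zero' (Eventually.of_forall fun _ => norm_nonneg _) ?_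
    (tendsto_integral_subsetSum G hlim hBi ?_)
  · filter_upwards [self_mem_nhdsWithin] with t ht
    refine norm_le_integral_subsetSum (hWi t ht) fun h hh hb1 => ?_
    have i1 := integrable_coe_mul G (measurable_subsetSum (thinWeight m σ C t) hh)
      (abs_subsetSum_thinWeight_le hm hσ hC0 hC t.coe_nonneg hb1)
    have i2 := integrable_coe_mul G hh hb1
    have i3 : Integrable (fun η => G η * subsetSum (genWeight m σ C) h η) (weighted d C) := by
      have e1 := (integrable_card_mul hGm hG2).mul_bdd hh.aestronglyMeasurable
        (Eventually.of_forall hb1)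
      have e2 := integrable_mul_sum_erase (C := C) hGm hG2 hh hb1
      refine ((e1.const_mul (-m)).add (e2.const_mul σ)).congr (Eventually.of_forall fun η => ?_)
      simp only [Pi.add_apply, subsetSum_genWeight]
      ring
    rw [integral_sub_mul _ _ hh hb1, integral_smul_mul, integral_sub_mul _ _ hh hb1,
      hT.dual t G h hh hb1, integral_mul_of_mem_lHatGraph hd hC0 hGH hh hb1,
      ← integral_sub i1 i2, ← integral_const_mul,
      ← integral_sub (f := fun η => (t : ℝ)⁻¹ *
        (G η * subsetSum (thinWeight m σ C t) h η - G η * h η)) ((i1.sub i2).const_mul _) i3]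
    refine integral_congr_ae (Eventually.of_forall fun η => ?_)
    simp only [W]
    rw [subsetSum_sub, subsetSum_const_mul, subsetSum_sub, subsetSum_thinWeight_zero]
    ring
  · filter_upwards [self_mem_nhdsWithin] with t ht
    exact hWB t ht

/-- Thinning preserves the domain: `∑_{ζ ⊆ η} p^{|ζ|} q^{|η \ ζ|} 2^{|ζ|} = (2 p + q)^{|η|}` is at
most `2^{|η|}`. -/
theorem IsThinning.integrable_two_mul {T : ℝ≥0 → LC d C →L[ℝ] LC d C}
    (hT : IsThinning d m σ C T) (hm : 0 < m) (hσ : 0 ≤ σ) (hC0 : 0 < C) (hC : σ / m ≤ C)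
    (t : ℝ≥0) {G : LC d C} (hG : Integrable G (weighted d (2 * C))) :
    Integrable (T t G) (weighted d (2 * C)) := by
  have h2 : Measurable fun η : FinConf d => (2 : ℝ≥0∞) ^ η.card :=
    measurable_const.pow measurable_card
  have hle : ENNReal.ofReal (survival m t) * 2 + ENNReal.ofReal (deletion m σ C t) ≤ 2 := by
    have hs := survival_nonneg m t
    have hq := deletion_nonneg hm hσ hC0 t.coe_nonneg
    have h1 := survival_add_deletion_le hm hC0 hC t.coe_nonneg
    have h3 := survival_le_one hm t.coe_nonneg
    rw [← ENNReal.ofReal_ofNat 2, ← ENNReal.ofReal_mul hs,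
      ← ENNReal.ofReal_add (mul_nonneg hs zero_le_two) hq]
    exact ENNReal.ofReal_le_ofReal (by linarith)
  refine ⟨(measurable_coe_Lp _).aestronglyMeasurable, ?_⟩
  rw [HasFiniteIntegral, lintegral_weighted_two_mul d C (measurable_coe_Lp _).enorm]
  refine (hT.lintegral_le t G _ h2).trans_lt (lt_of_le_of_lt (lintegral_mono fun η => ?_)
    ((lintegral_weighted_two_mul d C (measurable_coe_Lp G).enorm).symm.trans_lt hG.2))
  dsimp only
  rw [subsetSum_const_pow]
  gcongr

theorem dense_domain_lHatGraph (hd : 0 < d) (hC0 : 0 < C) :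
    Dense {G : LC d C | ∃ H, (G, H) ∈ lHatGraph d m σ C} := by
  intro G
  have hGi := integrable_coe_Lp G
  let s : ℕ → Set (FinConf d) := fun N => {η | η.card ≤ N}
  have hs : ∀ N, MeasurableSet (s N) := fun N =>
    measurableSet_le measurable_card measurable_const
  have hGN : ∀ N, Integrable ((s N).indicator G) (weighted d C) := fun N => hGi.indicator (hs N)
  refine mem_closure_of_tendsto (f := fun N => (hGN N).toL1) (b := atTop) ?_
    (Eventually.of_forall fun N => ?_)
  · rw [tendsto_iff_norm_sub_tendsto_zero]
    have h0 : (0 : ℝ) = ∫ _η, (0 : ℝ) ∂(weighted d C) := by simp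
    have e : ∀ N, ‖(hGN N).toL1 - G‖ = ∫ η, ‖(s N).indicator G η - G η‖ ∂(weighted d C) := by
      intro N
      rw [L1.norm_eq_integral_norm]
      refine integral_congr_ae ?_
      filter_upwards [Lp.coeFn_sub (hGN N).toL1 G, (hGN N).coeFn_toL1] with η h1 h2
      rw [h1, Pi.sub_apply, h2]
    simp only [e]
    rw [h0]
    refine tendsto_integral_of_dominated_convergence (fun η => ‖G η‖)
      (fun N => ((hGN N).sub hGi).norm.aestronglyMeasurable) hGi.norm
      (fun N => Eventually.of_forall fun η => ?_) (Eventually.of_forall fun η => ?_)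
    · by_cases h : η ∈ s N <;> simp [h]
    · refine tendsto_const_nhds.congr' ?_
      filter_upwards [eventually_ge_atTop η.card] with N hN
      have : η ∈ s N := hN
      simp [this]
  · have h1 : Integrable ((hGN N).toL1) (weighted d (2 * C)) := by
      rw [integrable_two_mul_congr hC0 (hGN N).coeFn_toL1,
        integrable_weighted_two_mul_iff ((measurable_coe_Lp G).indicator (hs N))]
      refine (hGi.norm.const_mul (2 ^ N)).mono' ((measurable_const.pow measurable_card).mul
        ((measurable_coe_Lp G).indicator (hs N))).aestronglyMeasurable
        (Eventually.of_forall fun η => ?_)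
      by_cases h : η ∈ s N
      · simp only [h, Set.indicator_of_mem, norm_mul, norm_pow, Real.norm_ofNat]
        exact mul_le_mul_of_nonneg_right (pow_le_pow_right₀ one_le_two h) (norm_nonneg _)
      · simp [h]
    exact (existsUnique_mem_lHatGraph hd hC0 h1).exists

theorem IsThinning.isHatSemigroup {T : ℝ≥0 → LC d C →L[ℝ] LC d C} (hT : IsThinning d m σ C T)
    (hd : 0 < d) (hm : 0 < m) (hσ : 0 ≤ σ) (hC0 : 0 < C) (hC : σ / m ≤ C) :
    IsHatSemigroup d m σ C T := by
  have hs := hT.isC0ContractionSemigroup hm hσ hC0 hC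
  refine ⟨hs, (hs.closure_eq_generatorGraph _ (hT.lHatGraph_subset hd hm hσ hC0 hC)
    (dense_domain_lHatGraph hd hC0) fun t G H hGH => ?_).symm⟩
  exact (existsUnique_mem_lHatGraph hd hC0 (hT.integrable_two_mul hm hσ hC0 hC t
    (integrable_of_mem_lHatGraph hC0 hGH))).exists

theorem IsHatSemigroup.unique (hd : 0 < d) (hC0 : 0 < C) {T S : ℝ≥0 → LC d C →L[ℝ] LC d C}
    (hT : IsHatSemigroup d m σ C T) (hS : IsHatSemigroup d m σ C S) : T = S := by
  refine hT.1.eq_of_generatorGraph_eq hS.1 (hT.2.trans hS.2.symm)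
    ((dense_domain_lHatGraph (m := m) (σ := σ) hd hC0).mono ?_)
  rintro G ⟨H, h⟩
  exact ⟨H, hT.2 ▸ subset_closure h⟩

end Generator

/-! ### The adjoint semigroup -/

section Adjoint

variable {d : ℕ} {m σ C : ℝ}

theorem integral_weighted (hC0 : 0 < C) (f : FinConf d → ℝ) :
    ∫ η, f η ∂(weighted d C) = ∫ η, C ^ η.card * f η ∂(lebesguePoisson d) := by
  rw [weighted, integral_withDensity_eq_integral_toReal_smul
    (measurable_const.pow measurable_card) (by simp)]
  simp [hC0.le]

theorem pairing_eq_integral_weighted (hC0 : 0 < C) (G : LC d C) (κ : KC d C) :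
    pairing G κ = ∫ η, G η * ((C ^ η.card)⁻¹ * κ.1 η) ∂(weighted d C) := by
  rw [integral_weighted hC0, pairing]
  refine integral_congr_ae (Eventually.of_forall fun η => ?_)
  have : C ^ η.card ≠ 0 := (pow_pos hC0 _).ne'
  field_simp

theorem ae_abs_le_of_mem_KC (κ : KC d C) :
    ∃ c : ℝ, 0 < c ∧ ∀ᵐ η ∂(lebesguePoisson d), |(C ^ η.card)⁻¹ * κ.1 η| ≤ c := by
  have h := κ.2
  change MemLp (fun η => (C ^ η.card)⁻¹ * κ.1 η) ∞ (lebesguePoisson d) at h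
  have h2 : eLpNormEssSup (fun η => (C ^ η.card)⁻¹ * κ.1 η) (lebesguePoisson d) ≠ ∞ := by
    simpa using h.2.ne
  refine ⟨max (eLpNormEssSup (fun η => (C ^ η.card)⁻¹ * κ.1 η) (lebesguePoisson d)).toReal 1,
    lt_max_of_lt_right one_pos, ?_⟩
  filter_upwards [ae_le_eLpNormEssSup (μ := lebesguePoisson d)
    (f := fun η => (C ^ η.card)⁻¹ * κ.1 η)] with η hη
  refine le_trans ?_ (le_max_left _ _)
  rw [← ENNReal.ofReal_le_ofReal_iff ENNReal.toReal_nonneg, ENNReal.ofReal_toReal h2,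
    ← Real.enorm_eq_ofReal_abs]
  exact hη

theorem measurable_inv_pow_mul {k : FinConf d → ℝ} (hk : Measurable k) :
    Measurable fun η : FinConf d => (C ^ η.card)⁻¹ * k η :=
  (measurable_const.pow measurable_card).inv.mul hk

/-- The class of `C^{-|·|} k` has a representative that is bounded everywhere. -/
theorem exists_bounded_representative (κ : KC d C) :
    ∃ c : ℝ, 0 < c ∧ ∃ h : FinConf d → ℝ, Measurable h ∧ (∀ η, |h η| ≤ c) ∧
      ∀ᵐ η ∂(lebesguePoisson d), (C ^ η.card)⁻¹ * κ.1 η = h η := by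
  obtain ⟨c, hc0, hc⟩ := ae_abs_le_of_mem_KC κ
  have hm : Measurable fun η : FinConf d => (C ^ η.card)⁻¹ * κ.1 η :=
    measurable_inv_pow_mul κ.1.measurable
  have hs : MeasurableSet {η : FinConf d | |(C ^ η.card)⁻¹ * κ.1 η| ≤ c} :=
    measurableSet_le hm.abs measurable_const
  refine ⟨c, hc0, _, hm.indicator hs, fun η => ?_, ?_⟩
  · by_cases h : η ∈ {η : FinConf d | |(C ^ η.card)⁻¹ * κ.1 η| ≤ c}
    · rw [Set.indicator_of_mem h]
      exact h
    · rw [Set.indicator_of_notMem h]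
      simpa using hc0.le
  · filter_upwards [hc] with η hη
    rw [Set.indicator_of_mem]
    exact hη

/-- The operator on `K_C` adjoint to thinning: conjugation by `C^{|·|}` turns densities with respect
to `C^{|η|} dλ` into densities with respect to `λ`. -/
noncomputable def adjointFun (m σ C t : ℝ) (k : FinConf d → ℝ) (η : FinConf d) : ℝ :=
  C ^ η.card * subsetSum (thinWeight m σ C t) (fun ζ => (C ^ ζ.card)⁻¹ * k ζ) η

theorem measurable_adjointFun (m σ C t : ℝ) {k : FinConf d → ℝ} (hk : Measurable k) :
    Measurable (adjointFun m σ C t k) :=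
  (measurable_const.pow measurable_card).mul (measurable_subsetSum _ (measurable_inv_pow_mul hk))

theorem subsetSum_congr_ae (hd : 0 < d) (W : ℕ → ℕ → ℝ) {k l : FinConf d → ℝ}
    (h : k =ᵐ[lebesguePoisson d] l) :
    subsetSum W k =ᵐ[lebesguePoisson d] subsetSum W l := by
  filter_upwards [ae_subset hd h] with η hη
  exact Finset.sum_congr rfl fun ζ hζ => by rw [hη ζ hζ]

theorem adjointFun_congr_ae (hd : 0 < d) (m σ C t : ℝ) {k l : FinConf d → ℝ}
    (h : k =ᵐ[lebesguePoisson d] l) :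
    adjointFun m σ C t k =ᵐ[lebesguePoisson d] adjointFun m σ C t l := by
  have h1 : (fun ζ : FinConf d => (C ^ ζ.card)⁻¹ * k ζ) =ᵐ[lebesguePoisson d]
      fun ζ => (C ^ ζ.card)⁻¹ * l ζ := h.mono fun η hη => by simp only [hη]
  filter_upwards [subsetSum_congr_ae hd (thinWeight m σ C t) h1] with η hη
  rw [adjointFun, adjointFun, hη]

open scoped Classical in
/-- After the substitution `ξ = η \ ζ` the two sums agree term by term, since
`e^{-tm} (σ / m) (e^{tm} - 1) = (σ / m) (1 - e^{-tm})`. -/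
theorem adjointFun_eq_conv (hm : 0 < m) (hC0 : 0 < C) (t : ℝ) (k : FinConf d → ℝ)
    (η : FinConf d) :
    adjointFun m σ C t k η = Real.exp (-(t * m * η.card)) *
      conv (coherent fun _ => σ / m * (Real.exp (t * m) - 1)) k η := by
  have hsa : survival m t * (σ / m * (Real.exp (t * m) - 1)) = C * deletion m σ C t := by
    have h1 : survival m t * Real.exp (t * m) = 1 := by
      rw [survival, ← Real.exp_add, neg_add_cancel, Real.exp_zero]
    have h2 : C * deletion m σ C t = σ / m * (1 - survival m t) := by
      rw [deletion]
      field_simp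
    rw [h2]
    linear_combination (σ / m) * h1
  have hexp : Real.exp (-(t * m * η.card)) = survival m t ^ η.card := by
    rw [survival, ← Real.exp_nat_mul]
    ring_nf
  rw [adjointFun, hexp, subsetSum, conv, Finset.mul_sum, Finset.mul_sum]
  refine Finset.sum_nbij' (fun ζ => η.pts \ ζ) (fun ξ => η.pts \ ξ) (fun ζ _ => by simp)
    (fun ξ _ => by simp) (fun ζ hζ => Finset.sdiff_sdiff_eq_self (Finset.mem_powerset.1 hζ))
    (fun ξ hξ => Finset.sdiff_sdiff_eq_self (Finset.mem_powerset.1 hξ)) fun ζ hζ => ?_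
  rw [Finset.sdiff_sdiff_eq_self (Finset.mem_powerset.1 hζ), coherent, Finset.prod_const]
  have hn : η.card = ζ.card + (η.pts \ ζ).card := by
    rw [add_comm, Finset.card_sdiff_add_card_eq_card (Finset.mem_powerset.1 hζ), card]
  have hCζ : C ^ ζ.card ≠ 0 := (pow_pos hC0 _).ne'
  rw [hn, thinWeight, pow_add, pow_add]
  have e : survival m t ^ (η.pts \ ζ).card * (σ / m * (Real.exp (t * m) - 1)) ^ (η.pts \ ζ).card =
      C ^ (η.pts \ ζ).card * deletion m σ C t ^ (η.pts \ ζ).card := by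
    rw [← mul_pow, hsa, mul_pow]
  change _ * (_ * ((C ^ ζ.card)⁻¹ * _)) = _
  calc _ = (C ^ ζ.card * (C ^ ζ.card)⁻¹) * survival m t ^ ζ.card *
        (C ^ (η.pts \ ζ).card * deletion m σ C t ^ (η.pts \ ζ).card) * k ⟨ζ⟩ := by ring
    _ = _ := by
      rw [mul_inv_cancel₀ hCζ, ← e]
      ring

theorem memLp_adjointFun (hd : 0 < d) (hm : 0 < m) (hσ : 0 ≤ σ) (hC0 : 0 < C) (hC : σ / m ≤ C)
    {t : ℝ} (ht : 0 ≤ t) (κ : KC d C) :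
    MemLp (fun η => (C ^ η.card)⁻¹ * adjointFun m σ C t κ.1 η) ∞ (lebesguePoisson d) := by
  obtain ⟨c, hc0, hc⟩ := ae_abs_le_of_mem_KC κ
  refine memLp_top_of_bound (measurable_inv_pow_mul
    (measurable_adjointFun m σ C t κ.1.measurable)).aestronglyMeasurable c ?_
  filter_upwards [ae_subset hd hc] with η hη
  rw [adjointFun, inv_mul_cancel_left₀ (pow_pos hC0 _).ne', Real.norm_eq_abs]
  calc |subsetSum (thinWeight m σ C t) (fun ζ => (C ^ ζ.card)⁻¹ * κ.1 ζ) η|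
      ≤ ∑ ζ ∈ η.pts.powerset, c * (thinWeight m σ C t ζ.card (η.pts.card - ζ.card) * 1) := by
        refine (Finset.abs_sum_le_sum_abs _ _).trans (Finset.sum_le_sum fun ζ hζ => ?_)
        rw [abs_mul, abs_of_nonneg (thinWeight_nonneg hm hσ hC0 ht _ _), mul_one, mul_comm c,
          Finset.card_sdiff_of_subset (Finset.mem_powerset.1 hζ)]
        exact mul_le_mul_of_nonneg_left (hη ζ hζ) (thinWeight_nonneg hm hσ hC0 ht _ _)
    _ ≤ c := by
        rw [← Finset.mul_sum]
        refine mul_le_of_le_one_right hc0.le (le_trans (le_of_eq ?_)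
          (subsetSum_thinWeight_one_le hm hσ hC0 hC ht η))
        refine Finset.sum_congr rfl fun ζ hζ => ?_
        rw [Finset.card_sdiff_of_subset (Finset.mem_powerset.1 hζ)]

/-- `adjointFun` as a linear operator on `K_C`. -/
noncomputable def adjointOp (hd : 0 < d) (hm : 0 < m) (hσ : 0 ≤ σ) (hC0 : 0 < C) (hC : σ / m ≤ C)
    (t : ℝ≥0) : KC d C →ₗ[ℝ] KC d C where
  toFun κ := ⟨AEEqFun.mk (adjointFun m σ C t κ.1)
      (measurable_adjointFun m σ C t κ.1.measurable).aestronglyMeasurable, by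
    refine (memLp_adjointFun hd hm hσ hC0 hC t.coe_nonneg κ).ae_eq ?_
    filter_upwards [AEEqFun.coeFn_mk (adjointFun m σ C t κ.1)
      (measurable_adjointFun m σ C t κ.1.measurable).aestronglyMeasurable] with η hη
    rw [hη]⟩
  map_add' κ κ' := by
    refine Subtype.ext (AEEqFun.ext ?_)
    refine (AEEqFun.coeFn_mk _ _).trans (EventuallyEq.trans ?_ (AEEqFun.coeFn_add _ _).symm)
    filter_upwards [adjointFun_congr_ae hd m σ C t (AEEqFun.coeFn_add κ.1 κ'.1),
      AEEqFun.coeFn_mk (adjointFun m σ C t κ.1)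
        (measurable_adjointFun m σ C t κ.1.measurable).aestronglyMeasurable,
      AEEqFun.coeFn_mk (adjointFun m σ C t κ'.1)
        (measurable_adjointFun m σ C t κ'.1.measurable).aestronglyMeasurable] with η h1 h2 h3
    change adjointFun m σ C t (κ.1 + κ'.1 : FinConf d →ₘ[lebesguePoisson d] ℝ) η = _
    rw [h1, Pi.add_apply, h2, h3]
    simp only [adjointFun, subsetSum, Pi.add_apply, mul_add, Finset.sum_add_distrib]
  map_smul' c κ := by
    refine Subtype.ext (AEEqFun.ext ?_)
    refine (AEEqFun.coeFn_mk _ _).trans (EventuallyEq.trans ?_ (AEEqFun.coeFn_smul _ _).symm)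
    filter_upwards [adjointFun_congr_ae hd m σ C t (AEEqFun.coeFn_smul c κ.1),
      AEEqFun.coeFn_mk (adjointFun m σ C t κ.1)
        (measurable_adjointFun m σ C t κ.1.measurable).aestronglyMeasurable] with η h1 h2
    change adjointFun m σ C t (c • κ.1 : FinConf d →ₘ[lebesguePoisson d] ℝ) η = _
    rw [h1, Pi.smul_apply, h2]
    simp only [adjointFun, subsetSum, Pi.smul_apply, smul_eq_mul, Finset.mul_sum, RingHom.id_apply]
    refine Finset.sum_congr rfl fun ζ _ => ?_
    ring

theorem coeFn_adjointOp (hd : 0 < d) (hm : 0 < m) (hσ : 0 ≤ σ) (hC0 : 0 < C) (hC : σ / m ≤ C)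
    (t : ℝ≥0) (κ : KC d C) :
    (adjointOp hd hm hσ hC0 hC t κ).1 =ᵐ[lebesguePoisson d] adjointFun m σ C t κ.1 :=
  AEEqFun.coeFn_mk _ _

theorem IsThinning.dual_of_bounded {T : ℝ≥0 → LC d C →L[ℝ] LC d C} (hT : IsThinning d m σ C T)
    (t : ℝ≥0) (G : LC d C) {h : FinConf d → ℝ} (hh : Measurable h) {c : ℝ} (hc : 0 < c)
    (hb : ∀ η, |h η| ≤ c) :
    ∫ η, T t G η * h η ∂(weighted d C) =
      ∫ η, G η * subsetSum (thinWeight m σ C t) h η ∂(weighted d C) := by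
  have key := hT.dual t G (fun η => c⁻¹ * h η) (hh.const_mul _) fun η => by
    rw [abs_mul, abs_of_pos (inv_pos.2 hc), inv_mul_le_iff₀ hc, mul_one]
    exact hb η
  have e : ∀ η, subsetSum (thinWeight m σ C t) (fun η => c⁻¹ * h η) η =
      c⁻¹ * subsetSum (thinWeight m σ C t) h η := fun η => by
    simp only [subsetSum, Finset.mul_sum, mul_left_comm]
  simp only [e, mul_left_comm _ c⁻¹, integral_const_mul] at key
  exact mul_left_cancel₀ (inv_ne_zero hc.ne') key

theorem IsThinning.isAdjointFamily {T : ℝ≥0 → LC d C →L[ℝ] LC d C} (hT : IsThinning d m σ C T)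
    (hd : 0 < d) (hm : 0 < m) (hσ : 0 ≤ σ) (hC0 : 0 < C) (hC : σ / m ≤ C) :
    IsAdjointFamily T (adjointOp hd hm hσ hC0 hC) := by
  intro t G κ
  obtain ⟨c, hc, h, hh, hb, hκ⟩ := exists_bounded_representative κ
  rw [pairing_eq_integral_weighted hC0, pairing_eq_integral_weighted hC0]
  calc _ = ∫ η, T t G η * h η ∂(weighted d C) := by
        refine integral_congr_ae ?_
        filter_upwards [(ae_weighted_iff hC0).2 hκ] with η hη
        rw [hη]
    _ = _ := hT.dual_of_bounded t G hh hc hb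
    _ = _ := by
        refine integral_congr_ae ?_
        filter_upwards [(ae_weighted_iff hC0).2 (coeFn_adjointOp hd hm hσ hC0 hC t κ),
          (ae_weighted_iff hC0).2 (subsetSum_congr_ae hd (thinWeight m σ C t) hκ)] with η h1 h2
        rw [h1, adjointFun, inv_mul_cancel_left₀ (pow_pos hC0 _).ne', h2]

/-- The duality between `L_C` and `K_C` separates `K_C`: test a bounded density `h` against
`G₀ h` with `G₀ > 0` integrable. -/
theorem eq_of_pairing_eq (hC0 : 0 < C) {κ κ' : KC d C}
    (h : ∀ G : LC d C, pairing G κ = pairing G κ') : κ = κ' := by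
  obtain ⟨c, hc, k, hk, hb, hκ⟩ := exists_bounded_representative κ
  obtain ⟨c', hc', k', hk', hb', hκ'⟩ := exists_bounded_representative κ'
  obtain ⟨w, hw0, hw, hwi⟩ := exists_pos_lintegral_lt_of_sigmaFinite (weighted d C) one_ne_zero
  have hwint : Integrable (fun η => (w η : ℝ)) (weighted d C) := by
    refine ⟨hw.coe_nnreal_real.aestronglyMeasurable, ?_⟩
    simpa [HasFiniteIntegral] using hwi.trans ENNReal.one_lt_top
  have hbd : ∀ η, |k η - k' η| ≤ c + c' := fun η =>
    (abs_sub _ _).trans (add_le_add (hb η) (hb' η))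
  have hGi : Integrable (fun η => (w η : ℝ) * (k η - k' η)) (weighted d C) :=
    hwint.mul_bdd (hk.sub hk').aestronglyMeasurable (Eventually.of_forall hbd)
  have hint : ∀ (l : FinConf d → ℝ), Measurable l → ∀ a : ℝ, (∀ η, |l η| ≤ a) →
      Integrable (fun η => (w η : ℝ) * (k η - k' η) * l η) (weighted d C) := fun l hl a ha =>
    hGi.mul_bdd hl.aestronglyMeasurable (Eventually.of_forall ha)
  have hpair : ∀ (κ : KC d C) (l : FinConf d → ℝ),
      (∀ᵐ η ∂(lebesguePoisson d), (C ^ η.card)⁻¹ * κ.1 η = l η) →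
      pairing (hGi.toL1 : LC d C) κ =
        ∫ η, (w η : ℝ) * (k η - k' η) * l η ∂(weighted d C) := by
    intro κ l hl
    rw [pairing_eq_integral_weighted hC0]
    refine integral_congr_ae ?_
    filter_upwards [hGi.coeFn_toL1, (ae_weighted_iff hC0).2 hl] with η h1 h2
    rw [h1, h2]
  have h0 : ∫ η, (w η : ℝ) * (k η - k' η) ^ 2 ∂(weighted d C) = 0 := by
    have h1 := h hGi.toL1
    rw [hpair κ k hκ, hpair κ' k' hκ', ← sub_eq_zero,
      ← integral_sub (hint k hk c hb) (hint k' hk' c' hb')] at h1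
    rw [← h1]
    refine integral_congr_ae (Eventually.of_forall fun η => ?_)
    ring
  have hi2 : Integrable (fun η => (w η : ℝ) * (k η - k' η) ^ 2) (weighted d C) :=
    (hint _ (hk.sub hk') _ hbd).congr (Eventually.of_forall fun η => by
      simp only [Pi.sub_apply]
      ring)
  rw [integral_eq_zero_iff_of_nonneg (fun η => by positivity) hi2] at h0
  refine Subtype.ext (AEEqFun.ext ?_)
  filter_upwards [(ae_weighted_iff hC0).1 h0, hκ, hκ'] with η h1 h2 h3
  have hw' : (w η : ℝ) ≠ 0 := by exact_mod_cast (hw0 η).ne'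
  have h4 : k η - k' η = 0 := by simpa [hw'] using h1
  have hCη : (C ^ η.card)⁻¹ ≠ 0 := inv_ne_zero (pow_pos hC0 _).ne'
  exact mul_left_cancel₀ hCη (by rw [h2, h3]; exact sub_eq_zero.1 h4)

end Adjoint

theorem mainTheorem6 (d : ℕ) (hd : 0 < d) (m σ C : ℝ) (hm : 0 < m) (hσ : 0 ≤ σ)
    (hC0 : 0 < C) (hC : σ / m ≤ C) :
    -- the operator `(L̂, L_{2C})` is well defined
    (∀ G : LC d C, Integrable G (FinConf.weighted d (2 * C)) →
      ∃! H : LC d C, (G, H) ∈ lHatGraph d m σ C) ∧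
    -- its closure generates exactly one contraction semigroup `T`,
    (∃! T : ℝ≥0 → LC d C →L[ℝ] LC d C, IsHatSemigroup d m σ C T) ∧
    ∀ T : ℝ≥0 → LC d C →L[ℝ] LC d C, IsHatSemigroup d m σ C T →
      -- whose adjoint family `S` on `K_C` exists, is unique,
      (∃! S : ℝ≥0 → KC d C →ₗ[ℝ] KC d C, IsAdjointFamily T S) ∧
      -- and acts by the explicit formula, for every measurable representative `k` of `κ`
      ∀ S : ℝ≥0 → KC d C →ₗ[ℝ] KC d C, IsAdjointFamily T S →
        ∀ (t : ℝ≥0) (κ : KC d C) (k : FinConf d → ℝ), Measurable k →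
          κ.1 =ᵐ[FinConf.lebesguePoisson d] k →
          (S t κ).1 =ᵐ[FinConf.lebesguePoisson d] fun η =>
            Real.exp (-(t * m * η.card)) *
              FinConf.conv
                (FinConf.coherent fun _ => σ / m * (Real.exp (t * m) - 1)) k η := by
  obtain ⟨T₀, hT₀⟩ := exists_isThinning hd hm hσ hC0 hC
  have hgen := hT₀.isHatSemigroup hd hm hσ hC0 hC
  have hadj := hT₀.isAdjointFamily hd hm hσ hC0 hC
  have huniq : ∀ S : ℝ≥0 → KC d C →ₗ[ℝ] KC d C, IsAdjointFamily T₀ S →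
      S = adjointOp hd hm hσ hC0 hC := fun S hS => by
    funext t
    exact LinearMap.ext fun κ => eq_of_pairing_eq hC0 fun G =>
      (hS t G κ).symm.trans (hadj t G κ)
  refine ⟨fun G hG => existsUnique_mem_lHatGraph hd hC0 hG,
    ⟨T₀, hgen, fun T hT => hT.unique hd hC0 hgen⟩, fun T hT => ?_⟩
  obtain rfl : T = T₀ := hT.unique hd hC0 hgen
  refine ⟨⟨_, hadj, huniq⟩, fun S hS t κ k _ hκ => ?_⟩
  rw [huniq S hS]
  filter_upwards [coeFn_adjointOp hd hm hσ hC0 hC t κ, adjointFun_congr_ae hd m σ C t hκ]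
    with η h1 h2
  rw [h1, h2, adjointFun_eq_conv hm hC0]
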